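/- Let $q\in\mathbb C$ with $0<|q|<1$, and write $(a;q)_n=\prod_{j=0}^{n-1}(1-aq^j)$ for $n\in\mathbb Z_{\ge0}\cup\{\infty\}$ and $(a_1,\dots,a_m;q)_n=\prod_{r}(a_r;q)_n$. Let $b,c,d,e\in\mathbb C\setminus\{0\}$, and put $$F(z)=\frac{\bigl(\frac{cz}{d},\frac{c}{dz},\frac{cz}{e},\frac{c}{ez};q\bigr)_\infty}{\bigl(cz,\frac cz,\frac{c^2z}{bde},\frac{c^2}{bdez};q\bigr)_\infty},\qquad A(z)=\frac{\bigl(\frac{cz}{de},\frac{c}{dez};q\bigr)_\infty}{\bigl(\frac{c^2z}{bde},\frac{c^2}{bdez};q\bigr)_\infty},\qquad B(z)=\frac{\bigl(bz,\frac bz;q\bigr)_\infty}{\bigl(cz,\frac cz;q\bigr)_\infty},$$ $$H(z)=\frac{\bigl(\frac{cz}{d},\frac{c}{dz},\frac{cz}{e},\frac{c}{ez};q\bigr)_\infty}{\bigl(cz,\frac cz,\frac{cz}{de},\frac{c}{dez};q\bigr)_\infty},\qquad K(z)=\frac{\bigl(\frac{cz}{d},\frac{c}{dz},\frac{cz}{e},\frac{c}{ez};q\bigr)_\infty}{\bigl(bz,\frac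 bz,\frac{c^2z}{bde},\frac{c^2}{bdez};q\bigr)_\infty},$$ $$\Phi_k(z;b,c)=\frac{(bz,\frac bz;q)_k}{(cz,\frac cz;q)_k},\qquad \Psi_k(z;b,c,d,e)=\frac{\bigl(\frac{cz}{de},\frac{c}{dez};q\bigr)_k}{\bigl(\frac{c^2z}{bde},\frac{c^2}{bdez};q\bigr)_k},$$ $$f_k=\frac{1-bcq^{2k-1}}{1-bcq^{-1}}\,\frac{\bigl(bcq^{-1},d,e,\frac{c^2}{deq};q\bigr)_k}{\bigl(q,\frac{bc}{d},\frac{bc}{e},\frac{bdeq}{c};q\bigr)_k}\,q^k,$$ $$g_k=\frac{1-\frac{c^3q^{2k-1}}{bd^2e^2}}{1-\frac{c^3}{bd^2e^2q}}\,\frac{\bigl(\frac{c^3}{bd^2e^2q},\frac{c}{bd},\frac{c}{be},\frac{c^2}{deq};q\bigr)_k}{\bigl(q,\frac{c^2}{de^2},\frac{c^2}{d^2e},\frac{cq}{bde};q\bigr)_k}\,q^k .$$ Assume that the parameters are generic in the sense that the denominators of $H(b)$, of $K(c/(de))$, and of $f_k$ and $g_k$ for all $k\ge0$ are nonzero. Call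 $z\in\mathbb C\setminus\{0\}$ admissible if $z$ is none of the points $cq^m$, $(cq^m)^{-1}$, $\frac{c^2}{bde}q^m$, $\bigl(\frac{c^2}{bde}q^m\bigr)^{-1}$ with $m\ge0$. Then for every admissible $z$ both series below converge absolutely and $$F(z)=A(z)\,H(b)\sum_{k=0}^\infty f_k\,\Phi_k(z;b,c)+B(z)\,K\!\left(\tfrac{c}{de}\right)\sum_{k=0}^\infty g_k\,\Psi_k(z;b,c,d,e).$$ On every compact set $L$ of admissible points that is symmetric ($z\in L\Rightarrow z^{-1}\in L$), both series converge uniformly, and the right-hand side with both series truncated after $N$ terms converges uniformly to $F$ as $N\to\infty$. Equivalently, for every admissible $z$, in expanded form, $$F(z)=A(z)H(b)\sum_{k=0}^\infty\frac{1-bcq^{2k-1}}{1-bcq^{-1}}\frac{\bigl(bcq^{-1},d,e,\frac{c^2}{deq},bz,\frac bz;q\bigr)_k}{\bigl(q,\frac{bc}{d},\frac{bc}{e},\frac{bdeq}{c},cz,\frac cz;q\bigr)_k}q^k$$ $$\qquad+B(z)K\!\left(\tfrac{c}{de}\right)\sum_{k=0}^\infty\frac{1-\frac{c^3q^{2k-1}}{bd^2e^2}}{1-\frac{c^3}{bd^2e^2q}}\frac{\bigl(\frac{c^3}{bd^2e^2q},\frac{c}{bd},\frac{c}{be},\frac{c^2}{deq},\frac{cz}{de},\frac{c}{dez};q\bigr)_k}{\bigl(q,\frac{c^2}{de^2},\frac{c^2}{d^2e},\frac{cq}{bde},\frac{c^2z}{bde},\frac{c^2}{bdez};q\bigr)_k}q^k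 ,$$ that is, Bailey's nonterminating ${}_8\phi_7$ summation in kernel form: $$F(z)=A(z)H(b)\;{}_8W_7\!\left(\tfrac{bc}{q};d,e,\tfrac{c^2}{deq},bz,\tfrac bz;q,q\right)+B(z)K\!\left(\tfrac{c}{de}\right){}_8W_7\!\left(\tfrac{c^3}{bd^2e^2q};\tfrac{c}{bd},\tfrac{c}{be},\tfrac{c^2}{deq},\tfrac{cz}{de},\tfrac{c}{dez};q,q\right),$$ where ${}_8W_7(a;b_1,\dots,b_5;q,x)=\sum_{k\ge0}\frac{1-aq^{2k}}{1-a}\frac{(a,b_1,\dots,b_5;q)_k}{(q,aq/b_1,\dots,aq/b_5;q)_k}x^k$. -/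

import Mathlib

noncomputable section

namespace TwoBasis

/-- The finite `q`-shifted factorial `(a;q)_n = ∏_{j<n} (1 - a q^j)`. -/
def qPoch (q a : ℂ) (n : ℕ) : ℂ := ∏ j ∈ Finset.range n, (1 - a * q ^ j)

/-- The infinite `q`-shifted factorial `(a;q)_∞ = ∏_{j≥0} (1 - a q^j)`
(the product converges absolutely for `|q| < 1`). -/
def qPochInf (q a : ℂ) : ℂ := ∏' j : ℕ, (1 - a * q ^ j)

/-- `(a₁,…,a_m;q)_n`. -/
def qPochs (q : ℂ) (as : List ℂ) (n : ℕ) : ℂ := (as.map fun a => qPoch q a n).prod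

/-- `(a₁,…,a_m;q)_∞`. -/
def qPochsInf (q : ℂ) (as : List ℂ) : ℂ := (as.map fun a => qPochInf q a).prod

/-- The kernel `F(z)`. -/
def F (q b c d e z : ℂ) : ℂ :=
  qPochsInf q [c * z / d, c / (d * z), c * z / e, c / (e * z)] /
    qPochsInf q [c * z, c / z, c ^ 2 * z / (b * d * e), c ^ 2 / (b * d * e * z)]

/-- The prefactor `A(z)`. -/
def A (q b c d e z : ℂ) : ℂ :=
  qPochsInf q [c * z / (d * e), c / (d * e * z)] /
    qPochsInf q [c ^ 2 * z / (b * d * e), c ^ 2 / (b * d * e * z)]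

/-- The prefactor `B(z)`. -/
def B (q b c z : ℂ) : ℂ :=
  qPochsInf q [b * z, b / z] / qPochsInf q [c * z, c / z]

/-- The normalized kernel `H = F / A`, as a quotient of products. -/
def H (q c d e z : ℂ) : ℂ :=
  qPochsInf q [c * z / d, c / (d * z), c * z / e, c / (e * z)] /
    qPochsInf q [c * z, c / z, c * z / (d * e), c / (d * e * z)]

/-- The normalized kernel `K = F / B`, as a quotient of products. -/
def K (q b c d e z : ℂ) : ℂ :=
  qPochsInf q [c * z / d, c / (d * z), c * z / e, c / (e * z)] /
    qPochsInf q [b * z, b / z, c ^ 2 * z / (b * d * e), c ^ 2 / (b * d * e * z)]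

/-- The rational basis `Φ_k(z;a,c)`. -/
def Phi (q a c : ℂ) (k : ℕ) (z : ℂ) : ℂ :=
  qPochs q [a * z, a / z] k / qPochs q [c * z, c / z] k

/-- The complementary rational basis `Ψ_k(z;b,c,d,e)`. -/
def Psi (q b c d e : ℂ) (k : ℕ) (z : ℂ) : ℂ :=
  qPochs q [c * z / (d * e), c / (d * e * z)] k /
    qPochs q [c ^ 2 * z / (b * d * e), c ^ 2 / (b * d * e * z)] k

/-- The coefficients `f_k`. -/
def fCoeff (q b c d e : ℂ) (k : ℕ) : ℂ :=
  (1 - b * c * q ^ (2 * (k : ℤ) - 1)) / (1 - b * c * q⁻¹) *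
    (qPochs q [b * c * q⁻¹, d, e, c ^ 2 / (d * e * q)] k /
      qPochs q [q, b * c / d, b * c / e, b * d * e * q / c] k) * q ^ k

/-- The coefficients `g_k`. -/
def gCoeff (q b c d e : ℂ) (k : ℕ) : ℂ :=
  (1 - c ^ 3 * q ^ (2 * (k : ℤ) - 1) / (b * d ^ 2 * e ^ 2)) /
      (1 - c ^ 3 / (b * d ^ 2 * e ^ 2 * q)) *
    (qPochs q [c ^ 3 / (b * d ^ 2 * e ^ 2 * q), c / (b * d), c / (b * e),
        c ^ 2 / (d * e * q)] k /
      qPochs q [q, c ^ 2 / (d * e ^ 2), c ^ 2 / (d ^ 2 * e), c * q / (b * d * e)] k) * q ^ k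

/-- The `k`-th summand of the very-well-poised series `W(a; b₁,…,b_m; q, x)`, that is
`(1 - a q^{2k})/(1 - a) · (a,b₁,…,b_m;q)_k / (q,aq/b₁,…,aq/b_m;q)_k · x^k`.
For `m = 5` the series is `₈W₇`. -/
def wTerm (q a : ℂ) (bs : List ℂ) (x : ℂ) (k : ℕ) : ℂ :=
  (1 - a * q ^ (2 * k)) / (1 - a) *
    (qPochs q (a :: bs) k / qPochs q (q :: bs.map fun b => a * q / b) k) * x ^ k

/-- The pole set `{c q^m, (c q^m)⁻¹ : m ≥ 0}` of `Φ_k(·;a,c)`, `k ≥ 0`. -/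
def poles (q c : ℂ) : Set ℂ := {z | ∃ m : ℕ, z = c * q ^ m ∨ z = (c * q ^ m)⁻¹}

/-- The points of `ℂ*` off the pole sets of both bases. -/
def admissible (q b c d e : ℂ) : Set ℂ :=
  {z | z ≠ 0 ∧ z ∉ poles q c ∧ z ∉ poles q (c ^ 2 / (b * d * e))}

/-- Genericity of the parameters: no parameter by which one divides is zero, and the denominators
of `H(b)`, `K(c/de)`, `f_k` and `g_k` do not vanish. -/
structure Generic (q b c d e : ℂ) : Prop where
  b_ne : b ≠ 0
  c_ne : c ≠ 0
  d_ne : d ≠ 0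
  e_ne : e ≠ 0
  H_den : qPochsInf q [b * c, c / b, b * c / (d * e), c / (b * d * e)] ≠ 0
  K_den : qPochsInf q [b * c / (d * e), b * d * e / c, c ^ 3 / (b * d ^ 2 * e ^ 2), c / b] ≠ 0
  f_den : 1 - b * c * q⁻¹ ≠ 0
  f_den' : ∀ k : ℕ, qPochs q [q, b * c / d, b * c / e, b * d * e * q / c] k ≠ 0
  g_den : 1 - c ^ 3 / (b * d ^ 2 * e ^ 2 * q) ≠ 0
  g_den' : ∀ k : ℕ,
    qPochs q [q, c ^ 2 / (d * e ^ 2), c ^ 2 / (d ^ 2 * e), c * q / (b * d * e)] k ≠ 0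

end TwoBasis

end

open TwoBasis

noncomputable section

namespace TwoBasis

open Filter Topology

/-! ### Finite and infinite `q`-shifted factorials: recursions, zeros, bounds, continuity. -/

section Pochhammer

variable {q : ℂ}

/-! The identity is Bailey's nonterminating `₈φ₇` summation for base `a = bc/q` and parameters
`c²/(deq), e, d, bz, b/z`. These satisfy the balancing condition `a²q = bcdef` (generic names) for
every `z`. With denominators cleared, the summation says that `twoSum`, a combination of two
very-well-poised series, equals a product (`twoSum_eq`), and it is proved as follows.

A telescoping sum gives an inhomogeneous contiguous relation for one series under `a, b, c ↦ aq, bq,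
cq` (`vwpSum_shift`). The involution `a ↦ b²/a`, `x ↦ bx/a` for `x = c, d, e, f`, with `b` fixed,
carries the first series to the second. In `twoSum` the inhomogeneous terms of the two relations
cancel, so `twoSum` is merely multiplied by an explicit factor (`twoSum_shift`), and `pairProd`
acquires the same factor (`pairProd_shift`).

Letting `c, d, e, f` take turns in the shift and iterating sends `a, b` to zero with `a/b` fixed,
and `c, d, e, f` to zero more slowly. Then `pairProd` tends to `1`, and `twoSum` tends to a
difference of two simple series in `r = a/b`. That difference is the theta product `(q, rq, 1/r;
q)_∞`, by a second contiguous relation that joins a collapsing series to the limiting one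
(`thetaSum_sub_thetaSum_inv`).

Convergence rests on one geometric bound, `norm_wpTerm_le`. It is uniform for bounded parameters,
and so serves both the limits in the parameters and uniformity in `z` on compact sets. -/

lemma qPoch_zero (q x : ℂ) : qPoch q x 0 = 1 := by simp [qPoch]

lemma qPoch_succ (q x : ℂ) (k : ℕ) : qPoch q x (k + 1) = qPoch q x k * (1 - x * q ^ k) := by
  simp [qPoch, Finset.prod_range_succ]

lemma qPoch_succ_left (q x : ℂ) (k : ℕ) :
    qPoch q x (k + 1) = (1 - x) * qPoch q (x * q) k := by
  simp only [qPoch, Finset.prod_range_succ', pow_zero, mul_one]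
  rw [mul_comm]
  congr 1
  exact Finset.prod_congr rfl fun j _ => by ring

lemma summable_norm_mul_pow (hq : ‖q‖ < 1) (x : ℂ) : Summable fun j : ℕ => ‖-(x * q ^ j)‖ := by
  simpa using (summable_geometric_of_lt_one (norm_nonneg q) hq).mul_left ‖x‖

lemma multipliable_one_sub_mul_pow (hq : ‖q‖ < 1) (x : ℂ) :
    Multipliable fun j : ℕ => 1 - x * q ^ j := by
  simpa [sub_eq_add_neg] using multipliable_one_add_of_summable (summable_norm_mul_pow hq x)

lemma tendsto_qPoch (hq : ‖q‖ < 1) (x : ℂ) :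
    Tendsto (qPoch q x) atTop (𝓝 (qPochInf q x)) :=
  (multipliable_one_sub_mul_pow hq x).hasProd.tendsto_prod_nat

lemma qPochInf_eq (hq : ‖q‖ < 1) (x : ℂ) : qPochInf q x = (1 - x) * qPochInf q (x * q) := by
  refine tendsto_nhds_unique ((tendsto_qPoch hq x).comp (tendsto_add_atTop_nat 1)) ?_
  refine ((tendsto_qPoch hq (x * q)).const_mul (1 - x)).congr fun k => ?_
  simp [qPoch_succ_left]

lemma qPochInf_eq_qPoch_mul (hq : ‖q‖ < 1) (x : ℂ) (k : ℕ) :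
    qPochInf q x = qPoch q x k * qPochInf q (x * q ^ k) := by
  induction k with
  | zero => simp [qPoch_zero]
  | succ k ih =>
    rw [ih, qPochInf_eq hq (x * q ^ k), qPoch_succ]
    ring_nf

lemma qPochInf_zero (q : ℂ) : qPochInf q 0 = 1 := by simp [qPochInf]

lemma qPochInf_one (hq : ‖q‖ < 1) : qPochInf q 1 = 0 := by simp [qPochInf_eq hq 1]

lemma qPoch_one_succ (q : ℂ) (k : ℕ) : qPoch q 1 (k + 1) = 0 := by simp [qPoch_succ_left]

lemma qPochInf_ne_zero (hq : ‖q‖ < 1) {x : ℂ} (h : ∀ j : ℕ, 1 - x * q ^ j ≠ 0) :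
    qPochInf q x ≠ 0 := by
  have := tprod_one_add_ne_zero_of_summable (f := fun j : ℕ => -(x * q ^ j))
    (fun j => by simpa [sub_eq_add_neg] using h j) (summable_norm_mul_pow hq x)
  simpa [qPochInf, sub_eq_add_neg] using this

/-- Each factor `1 - x q^j` divides `(x;q)_{j+1}`, and a convergent product of this kind vanishes
only if a factor does. This turns genericity of the coefficients into nonvanishing of the products
used to clear denominators. -/
lemma qPochInf_ne_zero_of_qPoch (hq : ‖q‖ < 1) {x : ℂ} (h : ∀ k : ℕ, qPoch q x k ≠ 0) :
    qPochInf q x ≠ 0 :=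
  qPochInf_ne_zero hq fun j => right_ne_zero_of_mul (qPoch_succ q x j ▸ h (j + 1))

lemma continuous_qPochInf (hq : ‖q‖ < 1) : Continuous (qPochInf q) := by
  rw [continuous_iff_continuousAt]
  intro x
  have hs : Summable fun j : ℕ => (‖x‖ + 1) * ‖q‖ ^ j :=
    (summable_geometric_of_lt_one (norm_nonneg q) hq).mul_left _
  have := tendsto_tprod_one_add_of_dominated_convergence (𝓕 := 𝓝 x)
    (f := fun (y : ℂ) (j : ℕ) => -(y * q ^ j)) (g := fun j : ℕ => -(x * q ^ j)) hs
    (fun j => Continuous.tendsto (by fun_prop) x) ?_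
  · simp only [← sub_eq_add_neg] at this
    exact this
  · filter_upwards [Metric.ball_mem_nhds x one_pos] with y hy j
    rw [norm_neg, norm_mul, norm_pow]
    gcongr
    have h1 : ‖y - x‖ < 1 := by simpa [dist_eq_norm] using hy
    linarith [norm_le_norm_add_norm_sub' y x]

/-- A bound for `(x;q)_k`, `k ≤ ∞`, on the disc `‖x‖ ≤ ρ`. -/
def pochBound (q : ℂ) (ρ : ℝ) : ℝ := Real.exp (ρ * (1 - ‖q‖)⁻¹)

lemma pochBound_pos (q : ℂ) (ρ : ℝ) : 0 < pochBound q ρ := Real.exp_pos _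

lemma norm_qPoch_le (hq : ‖q‖ < 1) {x : ℂ} {ρ : ℝ} (hx : ‖x‖ ≤ ρ) (k : ℕ) :
    ‖qPoch q x k‖ ≤ pochBound q ρ := by
  have h1 := Finset.norm_prod_one_add_sub_one_le (Finset.range k) fun j : ℕ => -(x * q ^ j)
  have h2 : ∑ j ∈ Finset.range k, ‖-(x * q ^ j)‖ ≤ ρ * (1 - ‖q‖)⁻¹ := by
    rw [← tsum_geometric_of_lt_one (norm_nonneg q) hq, ← tsum_mul_left]
    refine le_trans (Finset.sum_le_sum (g := fun j : ℕ => ρ * ‖q‖ ^ j) fun j _ => ?_)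
      (((summable_geometric_of_lt_one (norm_nonneg q) hq).mul_left ρ).sum_le_tsum _ fun j _ => ?_)
    · rw [norm_neg, norm_mul, norm_pow]
      gcongr
    · have := (norm_nonneg x).trans hx
      positivity
  have h3 := norm_le_norm_sub_add (∏ j ∈ Finset.range k, (1 + -(x * q ^ j))) 1
  simp only [norm_one] at h3
  have h4 := Real.exp_le_exp.2 h2
  simp only [qPoch, sub_eq_add_neg, pochBound] at *
  linarith

lemma norm_qPochInf_le (hq : ‖q‖ < 1) {x : ℂ} {ρ : ℝ} (hx : ‖x‖ ≤ ρ) :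
    ‖qPochInf q x‖ ≤ pochBound q ρ :=
  le_of_tendsto (tendsto_qPoch hq x).norm (Eventually.of_forall (norm_qPoch_le hq hx))

lemma norm_mul_pow_le (hq : ‖q‖ < 1) {x : ℂ} {ρ : ℝ} (hx : ‖x‖ ≤ ρ) (k : ℕ) :
    ‖x * q ^ k‖ ≤ ρ := by
  rw [norm_mul, norm_pow]
  exact (mul_le_of_le_one_right (norm_nonneg _) (pow_le_one₀ (norm_nonneg _) hq.le)).trans hx

lemma tendsto_qPochInf_mul_pow (hq : ‖q‖ < 1) (x : ℂ) :
    Tendsto (fun k : ℕ => qPochInf q (x * q ^ k)) atTop (𝓝 1) := by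
  have h := (tendsto_pow_atTop_nhds_zero_of_norm_lt_one hq).const_mul x
  rw [mul_zero] at h
  simpa [qPochInf_zero, Function.comp_def] using ((continuous_qPochInf hq).tendsto 0).comp h

lemma continuous_qPoch (q : ℂ) (k : ℕ) : Continuous fun x => qPoch q x k := by
  unfold qPoch
  fun_prop

lemma summable_of_norm_le_mul_pow (hq : ‖q‖ < 1) {u : ℕ → ℂ} {C : ℝ}
    (h : ∀ k, ‖u k‖ ≤ C * ‖q‖ ^ k) : Summable u :=
  .of_norm_bounded ((summable_geometric_of_lt_one (norm_nonneg q) hq).mul_left C) h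

end Pochhammer

/-! ### Series with cleared denominators: geometric bound, dependence on parameters, telescoping
identity. -/

section WellPoised

variable {q : ℂ}

/-- The `k`-th term of a very-well-poised series with numerator parameters `a, u i` and denominator
parameters `q, v i`, multiplied by all infinite products that clear its denominators. -/
def wpTerm (q a : ℂ) (u v : Fin 5 → ℂ) (k : ℕ) : ℂ :=
  (1 - a * q ^ (2 * k)) * q ^ k * (qPoch q a k * qPochInf q (q * q ^ k)) *
    ∏ i, (qPoch q (u i) k * qPochInf q (v i * q ^ k))

/-- The sum of the series `wpTerm`. -/
def wpSum (q a : ℂ) (u v : Fin 5 → ℂ) : ℂ := ∑' k, wpTerm q a u v k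

/-- The explicit `q^k` supplies the decay and all other factors are bounded. The exponent `12`
counts the factorials: two from `a` and `q`, ten from the five pairs. The condition `1 ≤ ρ` makes
`ρ` bound `q` as well. -/
lemma norm_wpTerm_le (hq : ‖q‖ < 1) {a : ℂ} {u v : Fin 5 → ℂ} {ρ : ℝ} (hρ : 1 ≤ ρ)
    (ha : ‖a‖ ≤ ρ) (hu : ∀ i, ‖u i‖ ≤ ρ) (hv : ∀ i, ‖v i‖ ≤ ρ) (k : ℕ) :
    ‖wpTerm q a u v k‖ ≤ (1 + ρ) * pochBound q ρ ^ 12 * ‖q‖ ^ k := by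
  have hB := (pochBound_pos q ρ).le
  have h1 : ‖1 - a * q ^ (2 * k)‖ ≤ 1 + ρ :=
    (norm_sub_le _ _).trans (by simpa using norm_mul_pow_le hq ha (2 * k))
  have h2 : ‖qPoch q a k * qPochInf q (q * q ^ k)‖ ≤ pochBound q ρ * pochBound q ρ := by
    rw [norm_mul]
    gcongr
    · exact norm_qPoch_le hq ha k
    · exact norm_qPochInf_le hq (norm_mul_pow_le hq (hq.le.trans hρ) k)
  have h3 : ‖∏ i, (qPoch q (u i) k * qPochInf q (v i * q ^ k))‖ ≤
      ∏ _i : Fin 5, (pochBound q ρ * pochBound q ρ) := by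
    rw [norm_prod]
    gcongr with i
    rw [norm_mul]
    gcongr
    · exact norm_qPoch_le hq (hu i) k
    · exact norm_qPochInf_le hq (norm_mul_pow_le hq (hv i) k)
  rw [wpTerm, norm_mul, norm_mul, norm_mul, norm_pow]
  calc _ ≤ (1 + ρ) * ‖q‖ ^ k * (pochBound q ρ * pochBound q ρ) *
        ∏ _i : Fin 5, (pochBound q ρ * pochBound q ρ) := by gcongr
    _ = _ := by
      simp only [Finset.prod_const, Finset.card_univ, Fintype.card_fin]
      ring

lemma exists_norm_le_param (a : ℂ) (u v : Fin 5 → ℂ) :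
    ∃ ρ : ℝ, 1 ≤ ρ ∧ ‖a‖ ≤ ρ ∧ (∀ i, ‖u i‖ ≤ ρ) ∧ ∀ i, ‖v i‖ ≤ ρ := by
  refine ⟨1 + ‖a‖ + ‖u‖ + ‖v‖, ?_, ?_, fun i => ?_, fun i => ?_⟩
  · linarith [norm_nonneg a, norm_nonneg u, norm_nonneg v]
  · linarith [norm_nonneg a, norm_nonneg u, norm_nonneg v]
  · linarith [norm_nonneg a, norm_le_pi_norm u i, norm_nonneg v]
  · linarith [norm_nonneg a, norm_le_pi_norm v i, norm_nonneg u]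

lemma summable_wpTerm (hq : ‖q‖ < 1) (a : ℂ) (u v : Fin 5 → ℂ) : Summable (wpTerm q a u v) := by
  obtain ⟨ρ, hρ, ha, hu, hv⟩ := exists_norm_le_param a u v
  exact summable_of_norm_le_mul_pow hq (norm_wpTerm_le hq hρ ha hu hv)

/-- Dominated convergence: a `ρ` strictly above the norms of the limits eventually bounds all the
parameters, so a single geometric majorant serves. -/
lemma tendsto_wpSum (hq : ‖q‖ < 1) {a : ℕ → ℂ} {u v : ℕ → Fin 5 → ℂ} {a₀ : ℂ}
    {u₀ v₀ : Fin 5 → ℂ} (ha : Tendsto a atTop (𝓝 a₀)) (hu : Tendsto u atTop (𝓝 u₀))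
    (hv : Tendsto v atTop (𝓝 v₀)) :
    Tendsto (fun n => wpSum q (a n) (u n) (v n)) atTop (𝓝 (wpSum q a₀ u₀ v₀)) := by
  obtain ⟨ρ, hρ, ha₀, hu₀, hv₀⟩ : ∃ ρ : ℝ, 1 ≤ ρ ∧ ‖a₀‖ < ρ ∧ ‖u₀‖ < ρ ∧ ‖v₀‖ < ρ := by
    refine ⟨1 + ‖a₀‖ + ‖u₀‖ + ‖v₀‖, ?_, ?_, ?_, ?_⟩ <;>
      linarith [norm_nonneg a₀, norm_nonneg u₀, norm_nonneg v₀]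
  refine tendsto_tsum_of_dominated_convergence
    ((summable_geometric_of_lt_one (norm_nonneg q) hq).mul_left ((1 + ρ) * pochBound q ρ ^ 12))
    (fun k => ?_) ?_
  · have hI := continuous_qPochInf hq
    have hP (x : ℕ → ℂ) (x₀ : ℂ) (h : Tendsto x atTop (𝓝 x₀)) :
        Tendsto (fun n => qPoch q (x n) k) atTop (𝓝 (qPoch q x₀ k)) :=
      ((continuous_qPoch q k).tendsto x₀).comp h
    refine (((tendsto_const_nhds.sub (ha.mul_const _)).mul_const _).mul
      ((hP _ _ ha).mul_const _)).mul (tendsto_finsetProd _ fun i _ => ?_)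
    exact (hP _ _ (tendsto_pi_nhds.1 hu i)).mul
      ((hI.tendsto _).comp ((tendsto_pi_nhds.1 hv i).mul_const _))
  · filter_upwards [ha.norm.eventually_lt_const ha₀, hu.norm.eventually_lt_const hu₀,
      hv.norm.eventually_lt_const hv₀] with n h1 h2 h3 k
    exact norm_wpTerm_le hq hρ h1.le (fun i => (norm_le_pi_norm _ i).trans h2.le)
      (fun i => (norm_le_pi_norm _ i).trans h3.le) k

/-- With `Q = q^k`, `k ≥ 1`, this is what remains of "term of the combined series = `G_k - G_{k-1}`"
after the common factorials are removed. -/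
lemma telescoping_identity {a b c d e f : ℂ} (q Q : ℂ) (ha : a ≠ 0) (hb : b ≠ 0) (hc : c ≠ 0)
    (hd : d ≠ 0) (he : e ≠ 0) (hf : f = a ^ 2 * q / (b * c * d * e)) (hq : q ≠ 0) :
    (1 - b) * (1 - c) * (1 - b * c / a) * ((1 - a * Q ^ 2) * Q * (1 - a * q / d * Q) *
        (1 - a * q / e * Q) * (1 - a * q / f * Q)) -
      (1 - a * q / (d * e)) * (1 - a * q / (d * f)) * (1 - a * q / (e * f)) *
        ((1 - a * q * Q ^ 2) * Q * (1 - a * Q) * (1 - b * Q) * (1 - c * Q)) =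
    -(b * c / a) * ((1 - b * c * q * Q) * ((1 - a * Q) * (1 - b * Q) * (1 - c * Q) *
        (1 - d * Q) * (1 - e * Q) * (1 - f * Q)) -
      (1 - b * c * Q) * ((1 - Q) * (1 - a / b * Q) * (1 - a / c * Q) *
        (1 - a * q / d * Q) * (1 - a * q / e * Q) * (1 - a * q / f * Q))) := by
  subst hf
  field_simp
  ring

end WellPoised

/-! ### Contiguous relations under `q`-shifts of `a, b, c`. -/

section Shift

variable {q a b c d e f : ℂ}

/-- The well-poised specialization `v i = a q / u i` of `wpSum`. -/
def vwpSum (q a b c d e f : ℂ) : ℂ :=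
  wpSum q a ![b, c, d, e, f] ![a * q / b, a * q / c, a * q / d, a * q / e, a * q / f]

/-- The case `Q = 1` with `(1-a)(1-b)(1-c)` cancelled. It is stated separately because that factor
may vanish. -/
lemma telescoping_identity_one (ha : a ≠ 0) (hb : b ≠ 0) (hc : c ≠ 0)
    (hd : d ≠ 0) (he : e ≠ 0) (hq : q ≠ 0) (hf : f = a ^ 2 * q / (b * c * d * e)) :
    (1 - b * c / a) * ((1 - a * q / d) * (1 - a * q / e) * (1 - a * q / f)) -
      (1 - a * q / (d * e)) * (1 - a * q / (d * f)) * (1 - a * q / (e * f)) * (1 - a * q) =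
    -(b * c / a) * ((1 - b * c * q) * ((1 - d) * (1 - e) * (1 - f))) := by
  subst hf
  field_simp
  ring

/-- The combination is chosen so that it telescopes; the right-hand side is the antidifference, and
its limit as `N → ∞` is the inhomogeneous term in `vwpSum_shift`. -/
lemma sum_range_wpTerm_sub (hq1 : ‖q‖ < 1) (hq : q ≠ 0) (ha : a ≠ 0) (hb : b ≠ 0) (hc : c ≠ 0)
    (hd : d ≠ 0) (he : e ≠ 0) (hf : f = a ^ 2 * q / (b * c * d * e)) (N : ℕ) :
    ∑ k ∈ Finset.range (N + 1), ((1 - b * c / a) *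
        wpTerm q a ![b, c, d, e, f] ![a * q / b, a * q / c, a * q / d, a * q / e, a * q / f] k -
      (1 - a) * ((1 - a * q / (d * e)) * (1 - a * q / (d * f)) * (1 - a * q / (e * f))) *
        wpTerm q (a * q) ![b * q, c * q, d, e, f]
          ![a * q / b, a * q / c, a * q / d * q, a * q / e * q, a * q / f * q] k) =
    -(b * c / a) * (1 - b * c * q * q ^ N) *
      (qPoch q a (N + 1) * qPoch q d (N + 1) * qPoch q e (N + 1) * qPoch q f (N + 1) *
        qPoch q (b * q) N * qPoch q (c * q) N) *
      (qPochInf q (q * q ^ N) * qPochInf q (a * q / b * q ^ N) * qPochInf q (a * q / c * q ^ N) *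
        qPochInf q (a * q / d * q * q ^ N) * qPochInf q (a * q / e * q * q ^ N) *
        qPochInf q (a * q / f * q * q ^ N)) := by
  have hI (x : ℂ) (k : ℕ) : qPochInf q (x * q ^ k) =
      (1 - x * q ^ k) * qPochInf q (x * q * q ^ k) := by
    rw [qPochInf_eq hq1]; congr 2; ring
  induction N with
  | zero =>
    have h := telescoping_identity_one ha hb hc hd he hq hf
    simp only [zero_add, Finset.sum_range_one, wpTerm, Fin.prod_univ_five, Matrix.cons_val,
      qPoch_zero, qPoch_succ, hI (a * q / d), hI (a * q / e), hI (a * q / f)]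
    simp only [pow_zero, mul_zero, mul_one, one_mul]
    linear_combination ((1 - a) * (qPochInf q q * qPochInf q (a * q / b) * qPochInf q (a * q / c) *
        qPochInf q (a * q / d * q) * qPochInf q (a * q / e * q) *
        qPochInf q (a * q / f * q))) * h
  | succ N ih =>
    rw [Finset.sum_range_succ, ih]
    have h := telescoping_identity q (q ^ (N + 1)) ha hb hc hd he hf hq
    -- Reconciles the bases `a` and `aq`. The other factorials are brought to common ones by peeling
    -- off single factors, which leaves a rational identity in `Q = q^(N+1)`.
    have hA : (1 - a) * qPoch q (a * q) (N + 1) = qPoch q a (N + 1) * (1 - a * q ^ (N + 1)) := by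
      rw [← qPoch_succ_left, qPoch_succ]
    have hI' (x : ℂ) : qPochInf q (x * q ^ N) =
        (1 - x * q ^ N) * qPochInf q (x * q ^ (N + 1)) := by
      rw [qPochInf_eq hq1, pow_succ, ← mul_assoc]
    have hIr (x : ℂ) : qPochInf q (x * q ^ (N + 1)) =
        (1 - x * q ^ (N + 1)) * qPochInf q (x * q * q ^ (N + 1)) := hI x (N + 1)
    have hIs (x : ℂ) : qPochInf q (x * q * q ^ N) = qPochInf q (x * q ^ (N + 1)) := by
      congr 1; ring
    simp only [wpTerm, Fin.prod_univ_five, Matrix.cons_val]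
    rw [qPoch_succ_left q b N, qPoch_succ_left q c N, qPoch_succ q (b * q) N,
      qPoch_succ q (c * q) N, hI' q, hI' (a * q / b), hI' (a * q / c), hIs, hIs, hIs,
      hIr (a * q / d), hIr (a * q / e), hIr (a * q / f)]
    simp only [qPoch_succ q _ (N + 1)]
    generalize qPoch q (a * q) (N + 1) = A' at *
    generalize qPoch q a (N + 1) = A at *
    generalize qPoch q d (N + 1) = pd
    generalize qPoch q e (N + 1) = pe
    generalize qPoch q f (N + 1) = pf
    generalize qPoch q (b * q) N = pb
    generalize qPoch q (c * q) N = pc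
    generalize qPochInf q (q * q ^ (N + 1)) = iq
    generalize qPochInf q (a * q / b * q ^ (N + 1)) = ib
    generalize qPochInf q (a * q / c * q ^ (N + 1)) = ic
    generalize qPochInf q (a * q / d * q * q ^ (N + 1)) = jd
    generalize qPochInf q (a * q / e * q * q ^ (N + 1)) = je
    generalize qPochInf q (a * q / f * q * q ^ (N + 1)) = jf
    have e1 : q * q ^ N = q ^ (N + 1) := by ring
    have e2 : a * q / b * q ^ N = a / b * q ^ (N + 1) := by ring
    have e3 : a * q / c * q ^ N = a / c * q ^ (N + 1) := by ring
    have e4 (x : ℂ) : x * q * q ^ N = x * q ^ (N + 1) := by ring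
    have e5 : q ^ (2 * (N + 1)) = (q ^ (N + 1)) ^ 2 := by ring
    rw [e1, e2, e3, e5, e4 (b * c), e4 b, e4 c]
    generalize q ^ (N + 1) = Q at *
    linear_combination (A * pd * pe * pf * pb * pc * iq * ib * ic * jd * je * jf) * h -
      ((1 - a * q / (d * e)) * (1 - a * q / (d * f)) * (1 - a * q / (e * f)) *
        (1 - a * q * Q ^ 2) * Q * (1 - b * Q) * (1 - c * Q) *
        (pd * pe * pf * pb * pc * iq * ib * ic * jd * je * jf)) * hA

lemma vwpSum_shift (hq1 : ‖q‖ < 1) (hq : q ≠ 0) (ha : a ≠ 0) (hb : b ≠ 0) (hc : c ≠ 0)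
    (hd : d ≠ 0) (he : e ≠ 0) (hf : f = a ^ 2 * q / (b * c * d * e)) :
    (1 - b * c / a) * vwpSum q a b c d e f -
      (1 - a) * ((1 - a * q / (d * e)) * (1 - a * q / (d * f)) * (1 - a * q / (e * f))) *
        vwpSum q (a * q) (b * q) (c * q) d e f =
    -(b * c / a) * (qPochInf q a * qPochInf q d * qPochInf q e * qPochInf q f *
        qPochInf q (b * q) * qPochInf q (c * q)) := by
  have hv : vwpSum q (a * q) (b * q) (c * q) d e f = wpSum q (a * q) ![b * q, c * q, d, e, f]
      ![a * q / b, a * q / c, a * q / d * q, a * q / e * q, a * q / f * q] := by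
    unfold vwpSum
    congr 2
    · field_simp
    · congr 1
      · field_simp
      · simp only [div_mul_eq_mul_div]
  rw [hv, vwpSum, wpSum, wpSum]
  refine tendsto_nhds_unique (((((summable_wpTerm hq1 _ _ _).hasSum.mul_left _).sub
    ((summable_wpTerm hq1 _ _ _).hasSum.mul_left _)).tendsto_sum_nat).comp
    (tendsto_add_atTop_nat 1)) ?_
  simp only [Function.comp_def, sum_range_wpTerm_sub hq1 hq ha hb hc hd he hf]
  have hp (x : ℂ) := (tendsto_qPoch hq1 x).comp (tendsto_add_atTop_nat 1)
  have hI (x : ℂ) := tendsto_qPochInf_mul_pow hq1 x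
  have h0 : Tendsto (fun N : ℕ => 1 - b * c * q * q ^ N) atTop (𝓝 (1 - b * c * q * 0)) :=
    ((tendsto_pow_atTop_nhds_zero_of_norm_lt_one hq1).const_mul _).const_sub _
  have := ((h0.const_mul (-(b * c / a))).mul ((((((hp a).mul (hp d)).mul (hp e)).mul (hp f)).mul
    (tendsto_qPoch hq1 (b * q))).mul (tendsto_qPoch hq1 (c * q)))).mul
    ((((((hI q).mul (hI (a * q / b))).mul (hI (a * q / c))).mul (hI (a * q / d * q))).mul
      (hI (a * q / e * q))).mul (hI (a * q / f * q)))
  simpa [Function.comp_def] using this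

/-- The combination of the two very-well-poised series in the nonterminating `₈φ₇` summation,
with denominators cleared. -/
def twoSum (q a b c d e f : ℂ) : ℂ :=
  qPochInf q (b ^ 2 / a) * (qPochInf q (b * c / a) * qPochInf q (b * d / a) *
      qPochInf q (b * e / a) * qPochInf q (b * f / a)) * vwpSum q a b c d e f -
    b / a * (qPochInf q a * (qPochInf q c * qPochInf q d * qPochInf q e * qPochInf q f)) *
      vwpSum q (b ^ 2 / a) b (b * c / a) (b * d / a) (b * e / a) (b * f / a)

/-- The factors of the product side of the nonterminating `₈φ₇` summation that are not invariant
under `q`-shifts of the parameters. -/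
def pairProd (q a b c d e f : ℂ) : ℂ :=
  qPochInf q a * qPochInf q (b ^ 2 / a) * (qPochInf q (a * q / (c * d)) *
    qPochInf q (a * q / (c * e)) * qPochInf q (a * q / (c * f)) * qPochInf q (a * q / (d * e)) *
    qPochInf q (a * q / (d * f)) * qPochInf q (a * q / (e * f)))

/-- The contiguous relation is applied to both series. The factors `1 - bc/a` and `1 - c` on their
left sides are the leading factors of `(bc/a)_∞` and `(c)_∞` in the weights, and the weight `b/a`
makes the inhomogeneous terms equal, so they cancel. -/
lemma twoSum_shift (hq1 : ‖q‖ < 1) (hq : q ≠ 0) (ha : a ≠ 0) (hb : b ≠ 0) (hc : c ≠ 0)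
    (hd : d ≠ 0) (he : e ≠ 0) (hf : f = a ^ 2 * q / (b * c * d * e)) :
    twoSum q a b c d e f = (1 - a) * (1 - b ^ 2 / a) *
      ((1 - a * q / (d * e)) * (1 - a * q / (d * f)) * (1 - a * q / (e * f))) *
      twoSum q (a * q) (b * q) (c * q) d e f := by
  have hf0 : f ≠ 0 := by rw [hf]; positivity
  have h1 := vwpSum_shift hq1 hq ha hb hc hd he hf
  have h2 := vwpSum_shift (a := b ^ 2 / a) (b := b) (c := b * c / a) (d := b * d / a)
    (e := b * e / a) (f := b * f / a) hq1 hq (by positivity) hb (by positivity) (by positivity)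
    (by positivity) (by rw [hf]; field_simp)
  -- The involution exchanges `bc/a` with `c` and fixes `aq/(de)`, `aq/(df)`, `aq/(ef)`. Hence both
  -- series acquire the same three shift factors.
  have r0 : b * (b * c / a) / (b ^ 2 / a) = c := by field_simp
  have r1 : b ^ 2 / a * q / (b * d / a * (b * e / a)) = a * q / (d * e) := by field_simp
  have r2 : b ^ 2 / a * q / (b * d / a * (b * f / a)) = a * q / (d * f) := by field_simp
  have r3 : b ^ 2 / a * q / (b * e / a * (b * f / a)) = a * q / (e * f) := by field_simp
  rw [r0, r1, r2, r3] at h2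
  have s0 : (b * q) ^ 2 / (a * q) = b ^ 2 / a * q := by field_simp
  have s1 : b * q * (c * q) / (a * q) = b * c / a * q := by field_simp
  have s2 (x : ℂ) : b * q * x / (a * q) = b * x / a := by field_simp
  have s3 : b * q / (a * q) = b / a := by field_simp
  simp only [twoSum]
  rw [s0, s1, s2, s2, s2, s3, qPochInf_eq hq1 a, qPochInf_eq hq1 (b ^ 2 / a),
    qPochInf_eq hq1 c, qPochInf_eq hq1 (b * c / a)]
  rw [qPochInf_eq hq1 a] at h1
  rw [qPochInf_eq hq1 (b ^ 2 / a)] at h2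
  linear_combination ((1 - b ^ 2 / a) * qPochInf q (b ^ 2 / a * q) * qPochInf q (b * c / a * q) *
      qPochInf q (b * d / a) * qPochInf q (b * e / a) * qPochInf q (b * f / a)) * h1 -
    (b / a * ((1 - a) * qPochInf q (a * q) * qPochInf q (c * q) * qPochInf q d * qPochInf q e *
      qPochInf q f)) * h2

lemma pairProd_shift (hq1 : ‖q‖ < 1) (hq : q ≠ 0) (ha : a ≠ 0) (hc : c ≠ 0) :
    pairProd q a b c d e f = (1 - a) * (1 - b ^ 2 / a) *
      ((1 - a * q / (d * e)) * (1 - a * q / (d * f)) * (1 - a * q / (e * f))) *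
      pairProd q (a * q) (b * q) (c * q) d e f := by
  have s0 : (b * q) ^ 2 / (a * q) = b ^ 2 / a * q := by field_simp
  have s1 (x : ℂ) : a * q * q / (c * q * x) = a * q / (c * x) := by field_simp
  have s2 (x : ℂ) : a * q * q / x = a * q / x * q := by ring
  simp only [pairProd]
  rw [s0, s1, s1, s1, s2, s2, s2, qPochInf_eq hq1 a, qPochInf_eq hq1 (b ^ 2 / a),
    qPochInf_eq hq1 (a * q / (d * e)), qPochInf_eq hq1 (a * q / (d * f)),
    qPochInf_eq hq1 (a * q / (e * f))]
  ring

end Shift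

/-! ### Iterated shifts, the limiting theta identity, and the cleared `₈φ₇` summation. -/

section Limit

variable {q a b c d e f : ℂ}

lemma vwpSum_rotate (q a b c d e f : ℂ) : vwpSum q a b c d e f = vwpSum q a b d e f c := by
  refine tsum_congr fun k => ?_
  simp only [wpTerm, Fin.prod_univ_five, Matrix.cons_val]
  ring

lemma twoSum_rotate (q a b c d e f : ℂ) : twoSum q a b c d e f = twoSum q a b d e f c := by
  rw [twoSum, twoSum, vwpSum_rotate, vwpSum_rotate q (b ^ 2 / a)]
  ring

lemma pairProd_rotate (q a b c d e f : ℂ) : pairProd q a b c d e f = pairProd q a b d e f c := by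
  rw [pairProd, pairProd, mul_comm c d, mul_comm c e, mul_comm c f]
  ring

/-- Moving the shifted `c` to the last place lets the next application shift `d`; after four
applications the original order returns. Only the fact that both quantities share the multiplier `t`
is retained. -/
lemma exists_shift_rotate (hq1 : ‖q‖ < 1) (hq : q ≠ 0) (ha : a ≠ 0) (hb : b ≠ 0) (hc : c ≠ 0)
    (hd : d ≠ 0) (he : e ≠ 0) (h : a ^ 2 * q = b * c * d * e * f) :
    ∃ t, twoSum q a b c d e f = t * twoSum q (a * q) (b * q) d e f (c * q) ∧
      pairProd q a b c d e f = t * pairProd q (a * q) (b * q) d e f (c * q) := by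
  have hf : f = a ^ 2 * q / (b * c * d * e) := by rw [h]; field_simp
  rw [← twoSum_rotate q (a * q) (b * q) (c * q) d e f,
    ← pairProd_rotate q (a * q) (b * q) (c * q) d e f]
  exact ⟨_, twoSum_shift hq1 hq ha hb hc hd he hf, pairProd_shift hq1 hq ha hc⟩

lemma exists_shift_all (hq1 : ‖q‖ < 1) (hq : q ≠ 0) (ha : a ≠ 0) (hb : b ≠ 0) (hc : c ≠ 0)
    (hd : d ≠ 0) (he : e ≠ 0) (hf : f ≠ 0) (h : a ^ 2 * q = b * c * d * e * f) :
    ∃ t, twoSum q a b c d e f =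
        t * twoSum q (a * q ^ 4) (b * q ^ 4) (c * q) (d * q) (e * q) (f * q) ∧
      pairProd q a b c d e f =
        t * pairProd q (a * q ^ 4) (b * q ^ 4) (c * q) (d * q) (e * q) (f * q) := by
  obtain ⟨t₁, h₁, h₁'⟩ := exists_shift_rotate hq1 hq ha hb hc hd he h
  obtain ⟨t₂, h₂, h₂'⟩ := exists_shift_rotate (a := a * q) (b := b * q) (c := d) (d := e) (e := f)
    (f := c * q) hq1 hq (by positivity) (by positivity) hd he hf (by linear_combination q ^ 2 * h)
  obtain ⟨t₃, h₃, h₃'⟩ := exists_shift_rotate (a := a * q * q) (b := b * q * q) (c := e) (d := f)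
    (e := c * q) (f := d * q) hq1 hq (by positivity) (by positivity) he hf (by positivity)
    (by linear_combination q ^ 4 * h)
  obtain ⟨t₄, h₄, h₄'⟩ := exists_shift_rotate (a := a * q * q * q) (b := b * q * q * q) (c := f)
    (d := c * q) (e := d * q) (f := e * q) hq1 hq (by positivity) (by positivity) hf
    (by positivity) (by positivity) (by linear_combination q ^ 6 * h)
  have e1 (x : ℂ) : x * q * q * q * q = x * q ^ 4 := by ring
  rw [e1, e1] at h₄ h₄'
  refine ⟨t₁ * t₂ * t₃ * t₄, ?_, ?_⟩
  · rw [h₁, h₂, h₃, h₄]; ring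
  · rw [h₁', h₂', h₃', h₄']; ring

lemma exists_shift_iterate (hq1 : ‖q‖ < 1) (hq : q ≠ 0) (ha : a ≠ 0) (hb : b ≠ 0) (hc : c ≠ 0)
    (hd : d ≠ 0) (he : e ≠ 0) (hf : f ≠ 0) (h : a ^ 2 * q = b * c * d * e * f) (n : ℕ) :
    ∃ t, twoSum q a b c d e f = t * twoSum q (a * q ^ (4 * n)) (b * q ^ (4 * n)) (c * q ^ n)
        (d * q ^ n) (e * q ^ n) (f * q ^ n) ∧
      pairProd q a b c d e f = t * pairProd q (a * q ^ (4 * n)) (b * q ^ (4 * n)) (c * q ^ n)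
        (d * q ^ n) (e * q ^ n) (f * q ^ n) := by
  induction n with
  | zero => exact ⟨1, by simp⟩
  | succ n ih =>
    obtain ⟨t, h₁, h₁'⟩ := ih
    obtain ⟨s, h₂, h₂'⟩ := exists_shift_all (a := a * q ^ (4 * n)) (b := b * q ^ (4 * n))
      (c := c * q ^ n) (d := d * q ^ n) (e := e * q ^ n) (f := f * q ^ n) hq1 hq (by positivity)
      (by positivity) (by positivity) (by positivity) (by positivity) (by positivity)
      (by linear_combination q ^ (8 * n) * h)
    have e1 (x : ℂ) : x * q ^ (4 * n) * q ^ 4 = x * q ^ (4 * (n + 1)) := by ring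
    have e2 (x : ℂ) : x * q ^ n * q = x * q ^ (n + 1) := by ring
    simp only [e1, e2] at h₂ h₂'
    refine ⟨t * s, ?_, ?_⟩
    · rw [h₁, h₂, mul_assoc]
    · rw [h₁', h₂', mul_assoc]

/-- The limiting series `∑ q^k (f;q)_k (q^{k+1}, r q^{k+1};q)_∞`. -/
def thetaSum (q r f : ℂ) : ℂ := wpSum q 0 ![f, 0, 0, 0, 0] ![r * q, 0, 0, 0, 0]

lemma tendsto_mul_pow (hq1 : ‖q‖ < 1) (x : ℂ) {m : ℕ} (hm : m ≠ 0) :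
    Tendsto (fun n : ℕ => x * q ^ (m * n)) atTop (𝓝 0) := by
  have h : ‖q ^ m‖ < 1 := by
    rw [norm_pow]; exact pow_lt_one₀ (norm_nonneg _) hq1 hm
  simpa [pow_mul] using (tendsto_pow_atTop_nhds_zero_of_norm_lt_one h).const_mul x

lemma tendsto_vec5 {x₀ x₁ x₂ x₃ x₄ : ℕ → ℂ} {y₀ y₁ y₂ y₃ y₄ : ℂ} (h₀ : Tendsto x₀ atTop (𝓝 y₀))
    (h₁ : Tendsto x₁ atTop (𝓝 y₁)) (h₂ : Tendsto x₂ atTop (𝓝 y₂)) (h₃ : Tendsto x₃ atTop (𝓝 y₃))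
    (h₄ : Tendsto x₄ atTop (𝓝 y₄)) :
    Tendsto (fun n => ![x₀ n, x₁ n, x₂ n, x₃ n, x₄ n]) atTop (𝓝 ![y₀, y₁, y₂, y₃, y₄]) := by
  refine tendsto_pi_nhds.2 fun i => ?_
  fin_cases i <;> assumption

/-- Each of `c, d, e, f` is shifted once per round but `a, b` four times. So `aq/c` and its
analogues decay like `q^(3n)`, while `aq/b` stays constant and is the only parameter to survive. -/
lemma tendsto_vwpSum (hq1 : ‖q‖ < 1) (hq : q ≠ 0) (a b c d e f : ℂ) :
    Tendsto (fun n : ℕ => vwpSum q (a * q ^ (4 * n)) (b * q ^ (4 * n)) (c * q ^ n) (d * q ^ n)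
      (e * q ^ n) (f * q ^ n)) atTop (𝓝 (thetaSum q (a / b) 0)) := by
  have h4 (x : ℂ) := tendsto_mul_pow hq1 x four_ne_zero
  have h1 (x : ℂ) : Tendsto (fun n : ℕ => x * q ^ n) atTop (𝓝 0) := by
    simpa using tendsto_mul_pow hq1 x one_ne_zero
  have h3 (x : ℂ) : Tendsto (fun n : ℕ => a * q ^ (4 * n) * q / (x * q ^ n)) atTop (𝓝 0) := by
    refine (tendsto_mul_pow hq1 (a * q / x) three_ne_zero).congr fun n => ?_
    rw [show a * q ^ (4 * n) * q = a * q * q ^ (3 * n) * q ^ n by ring,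
      mul_div_mul_right _ _ (pow_ne_zero n hq)]
    ring
  refine tendsto_wpSum hq1 (h4 a) (tendsto_vec5 (h4 b) (h1 c) (h1 d) (h1 e) (h1 f))
    (tendsto_vec5 ?_ (h3 c) (h3 d) (h3 e) (h3 f))
  refine tendsto_const_nhds.congr fun n => ?_
  rw [mul_right_comm, mul_div_mul_right _ _ (pow_ne_zero _ hq)]
  ring

lemma tendsto_twoSum (hq1 : ‖q‖ < 1) (hq : q ≠ 0) (ha : a ≠ 0) (hb : b ≠ 0) (c d e f : ℂ) :
    Tendsto (fun n : ℕ => twoSum q (a * q ^ (4 * n)) (b * q ^ (4 * n)) (c * q ^ n)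
        (d * q ^ n) (e * q ^ n) (f * q ^ n)) atTop
      (𝓝 (thetaSum q (a / b) 0 - b / a * thetaSum q (b / a) 0)) := by
  have hI := continuous_qPochInf hq1
  have h4 (x : ℂ) : Tendsto (fun n : ℕ => qPochInf q (x * q ^ (4 * n))) atTop (𝓝 1) := by
    simpa [Function.comp_def, qPochInf_zero] using
      (hI.tendsto 0).comp (tendsto_mul_pow hq1 x four_ne_zero)
  have h1 (x : ℂ) : Tendsto (fun n : ℕ => qPochInf q (x * q ^ n)) atTop (𝓝 1) :=
    tendsto_qPochInf_mul_pow hq1 x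
  have e1 (n : ℕ) : (b * q ^ (4 * n)) ^ 2 / (a * q ^ (4 * n)) = b ^ 2 / a * q ^ (4 * n) := by
    field_simp
  have e2 (n : ℕ) (x : ℂ) : b * q ^ (4 * n) * (x * q ^ n) / (a * q ^ (4 * n)) =
      b * x / a * q ^ n := by
    field_simp
  have e3 (n : ℕ) : b * q ^ (4 * n) / (a * q ^ (4 * n)) = b / a := by
    field_simp
  simp only [twoSum, e1, e2, e3]
  have h2 := tendsto_vwpSum hq1 hq (b ^ 2 / a) b (b * c / a) (b * d / a) (b * e / a) (b * f / a)
  rw [show b ^ 2 / a / b = b / a by field_simp] at h2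
  simpa using (((h4 _).mul ((((h1 _).mul (h1 _)).mul (h1 _)).mul (h1 _))).mul
    (tendsto_vwpSum hq1 hq a b c d e f)).sub
    ((((h4 a).mul ((((h1 c).mul (h1 d)).mul (h1 e)).mul (h1 f))).const_mul (b / a)).mul h2)

lemma tendsto_pairProd (hq1 : ‖q‖ < 1) (hq : q ≠ 0) (a b c d e f : ℂ) :
    Tendsto (fun n : ℕ => pairProd q (a * q ^ (4 * n)) (b * q ^ (4 * n)) (c * q ^ n)
        (d * q ^ n) (e * q ^ n) (f * q ^ n)) atTop (𝓝 1) := by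
  have hI := continuous_qPochInf hq1
  have h4 (x : ℂ) {m : ℕ} (hm : m ≠ 0) :
      Tendsto (fun n : ℕ => qPochInf q (x * q ^ (m * n))) atTop (𝓝 1) := by
    simpa [Function.comp_def, qPochInf_zero] using
      (hI.tendsto 0).comp (tendsto_mul_pow hq1 x hm)
  have e1 (n : ℕ) : (b * q ^ (4 * n)) ^ 2 / (a * q ^ (4 * n)) = b ^ 2 / a * q ^ (4 * n) := by
    rw [mul_pow, sq (q ^ _), ← mul_assoc, mul_div_mul_right _ _ (pow_ne_zero _ hq)]
    ring
  have e2 (n : ℕ) (x y : ℂ) : a * q ^ (4 * n) * q / (x * q ^ n * (y * q ^ n)) =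
      a * q / (x * y) * q ^ (2 * n) := by
    rw [show a * q ^ (4 * n) * q = a * q * q ^ (2 * n) * q ^ (2 * n) by ring,
      show x * q ^ n * (y * q ^ n) = x * y * q ^ (2 * n) by ring,
      mul_div_mul_right _ _ (pow_ne_zero _ hq)]
    ring
  have h2 (x y : ℂ) := h4 (a * q / (x * y)) two_ne_zero
  simp only [pairProd, e1, e2]
  simpa using ((h4 a four_ne_zero).mul (h4 (b ^ 2 / a) four_ne_zero)).mul
    ((((((h2 c d).mul (h2 c e)).mul (h2 c f)).mul (h2 d e)).mul (h2 d f)).mul (h2 e f))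

lemma sum_range_thetaSum_sub (hq1 : ‖q‖ < 1) {r : ℂ} (hr : r ≠ 0) (N : ℕ) :
    ∑ k ∈ Finset.range (N + 1), ((1 - f / r) *
        wpTerm q 0 ![f, 0, 0, 0, 0] ![r * q, 0, 0, 0, 0] k -
        wpTerm q 0 ![f * q, 0, 0, 0, 0] ![r * q, 0, 0, 0, 0] k) =
    -(f / r) * (qPoch q (f * q) N * (qPochInf q (q * q ^ N) * qPochInf q (r * q * q ^ N))) := by
  have hz (k : ℕ) : qPoch q 0 k = 1 := by simp [qPoch]
  induction N with
  | zero =>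
    simp [wpTerm, Fin.prod_univ_five, qPoch_zero, qPochInf_zero]
    ring
  | succ N ih =>
    rw [Finset.sum_range_succ, ih]
    have hI' (x : ℂ) : qPochInf q (x * q ^ N) =
        (1 - x * q ^ N) * qPochInf q (x * q ^ (N + 1)) := by
      rw [qPochInf_eq hq1, pow_succ, ← mul_assoc]
    simp only [wpTerm, Fin.prod_univ_five, Matrix.cons_val, zero_mul, qPochInf_zero, hz, mul_one,
      sub_zero, one_mul]
    rw [hI' q, hI' (r * q), qPoch_succ_left q f, qPoch_succ q (f * q)]
    field_simp
    ring

/-- The degenerate analogue of `vwpSum_shift`, again by telescoping. It moves `f` towards `0`, the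
value needed in the limit. -/
lemma thetaSum_shift (hq1 : ‖q‖ < 1) {r : ℂ} (hr : r ≠ 0) (f : ℂ) :
    (1 - f / r) * thetaSum q r f - thetaSum q r (f * q) = -(f / r) * qPochInf q (f * q) := by
  refine tendsto_nhds_unique (((((summable_wpTerm hq1 _ _ _).hasSum.mul_left _).sub
    (summable_wpTerm hq1 _ _ _).hasSum).tendsto_sum_nat).comp (tendsto_add_atTop_nat 1)) ?_
  simp only [Function.comp_def, sum_range_thetaSum_sub hq1 hr]
  simpa using ((tendsto_qPoch hq1 (f * q)).mul ((tendsto_qPochInf_mul_pow hq1 q).mul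
    (tendsto_qPochInf_mul_pow hq1 (r * q)))).const_mul (-(f / r))

lemma thetaSum_one (q r : ℂ) : thetaSum q r 1 = qPochInf q q * qPochInf q (r * q) := by
  rw [thetaSum, wpSum, tsum_eq_single 0]
  · simp [wpTerm, Fin.prod_univ_five, qPoch_zero, qPochInf_zero]
  · intro k hk
    obtain ⟨k, rfl⟩ := Nat.exists_eq_succ_of_ne_zero hk
    simp [wpTerm, Fin.prod_univ_five, qPoch_one_succ]

lemma tendsto_thetaSum (hq1 : ‖q‖ < 1) (r x : ℂ) :
    Tendsto (fun n : ℕ => thetaSum q r (x * q ^ n)) atTop (𝓝 (thetaSum q r 0)) := by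
  refine tendsto_wpSum hq1 tendsto_const_nhds (tendsto_vec5 ?_ tendsto_const_nhds
    tendsto_const_nhds tendsto_const_nhds tendsto_const_nhds) tendsto_const_nhds
  simpa using tendsto_mul_pow hq1 x one_ne_zero

/-- The theta function `(q, r q, 1/r; q)_∞` as a difference of two `q`-series. -/
lemma thetaSum_sub_thetaSum_inv (hq1 : ‖q‖ < 1) {r : ℂ} (hr : r ≠ 0) :
    thetaSum q r 0 - r⁻¹ * thetaSum q r⁻¹ 0 =
      qPochInf q q * qPochInf q (r * q) * qPochInf q r⁻¹ := by
  -- This combination does not depend on `n`. At `n = 0` the first series reduces to one term and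
  -- `(1;q)_∞ = 0` removes the second; as `n → ∞` both prefactors tend to `1` and the left side of
  -- the claim appears.
  have key (n : ℕ) : qPochInf q (r⁻¹ * q ^ n) * thetaSum q r (1 * q ^ n) -
      r⁻¹ * qPochInf q (1 * q ^ n) * thetaSum q r⁻¹ (r⁻¹ * q ^ n) =
      qPochInf q q * qPochInf q (r * q) * qPochInf q r⁻¹ := by
    induction n with
    | zero =>
      simp only [pow_zero, mul_one, qPochInf_one hq1, thetaSum_one]
      ring
    | succ n ih =>
      rw [← ih]
      have h1 := thetaSum_shift hq1 hr (1 * q ^ n)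
      have h2 := thetaSum_shift hq1 (inv_ne_zero hr) (r⁻¹ * q ^ n)
      have e1 (x : ℂ) : x * q ^ (n + 1) = x * q ^ n * q := by ring
      have e2 : 1 * q ^ n / r = r⁻¹ * q ^ n := by ring
      have e3 : r⁻¹ * q ^ n / r⁻¹ = 1 * q ^ n := by field_simp
      rw [e2] at h1
      rw [e3] at h2
      simp only [e1]
      rw [qPochInf_eq hq1 (r⁻¹ * q ^ n), qPochInf_eq hq1 (1 * q ^ n)]
      linear_combination (-qPochInf q (r⁻¹ * q ^ n * q)) * h1 +
        (r⁻¹ * qPochInf q (1 * q ^ n * q)) * h2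
  have hl := ((tendsto_qPochInf_mul_pow hq1 r⁻¹).mul (tendsto_thetaSum hq1 r 1)).sub
    (((tendsto_qPochInf_mul_pow hq1 1).const_mul r⁻¹).mul (tendsto_thetaSum hq1 r⁻¹ r⁻¹))
  simpa using tendsto_nhds_unique (hl.congr key) tendsto_const_nhds

/-- The nonterminating `₈φ₇` summation with denominators cleared. -/
theorem twoSum_eq (hq1 : ‖q‖ < 1) (hq : q ≠ 0) (ha : a ≠ 0) (hb : b ≠ 0) (hc : c ≠ 0)
    (hd : d ≠ 0) (he : e ≠ 0) (hf : f ≠ 0) (h : a ^ 2 * q = b * c * d * e * f) :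
    twoSum q a b c d e f =
      qPochInf q q * qPochInf q (a * q / b) * qPochInf q (b / a) * pairProd q a b c d e f := by
  have h1 := (tendsto_pairProd hq1 hq a b c d e f).const_mul (twoSum q a b c d e f)
  have h2 := (tendsto_twoSum hq1 hq ha hb c d e f).const_mul (pairProd q a b c d e f)
  -- The common multiplier `t` may vanish, so the shifted and unshifted quantities are
  -- cross-multiplied instead of divided.
  have h3 := tendsto_nhds_unique h1 (h2.congr fun n => by
    obtain ⟨t, ht, ht'⟩ := exists_shift_iterate hq1 hq ha hb hc hd he hf h n
    rw [ht, ht']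
    ring)
  have h4 := thetaSum_sub_thetaSum_inv hq1 (div_ne_zero ha hb)
  rw [inv_div, div_mul_eq_mul_div a] at h4
  rw [mul_one, h4] at h3
  rw [h3]
  ring

end Limit

/-! ### Kernel series as very-well-poised series. -/

section Kernel

variable {q b c d e z : ℂ}

lemma qPoch_div_eq (hq1 : ‖q‖ < 1) {x y : ℂ} (hy : qPochInf q y ≠ 0) (k : ℕ) :
    qPoch q x k / qPoch q y k = qPoch q x k * qPochInf q (y * q ^ k) / qPochInf q y := by
  rw [qPochInf_eq_qPoch_mul hq1 y k] at hy ⊢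
  rw [mul_div_mul_right _ _ (right_ne_zero_of_mul hy)]

/-- The third parameter goes first because in both kernel series it is `c²/(deq)`, the parameter
fixed by the involution in `twoSum`. -/
lemma wTerm_eq_wpTerm_div (hq1 : ‖q‖ < 1) {a b₁ b₂ b₃ b₄ b₅ : ℂ} (h : qPochInf q q ≠ 0)
    (h₁ : qPochInf q (a * q / b₁) ≠ 0) (h₂ : qPochInf q (a * q / b₂) ≠ 0)
    (h₃ : qPochInf q (a * q / b₃) ≠ 0) (h₄ : qPochInf q (a * q / b₄) ≠ 0)
    (h₅ : qPochInf q (a * q / b₅) ≠ 0) (k : ℕ) :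
    wTerm q a [b₁, b₂, b₃, b₄, b₅] q k =
      wpTerm q a ![b₃, b₁, b₂, b₄, b₅]
        ![a * q / b₃, a * q / b₁, a * q / b₂, a * q / b₄, a * q / b₅] k /
      ((1 - a) * qPochInf q q * qPochInf q (a * q / b₁) * qPochInf q (a * q / b₂) *
        qPochInf q (a * q / b₃) * qPochInf q (a * q / b₄) * qPochInf q (a * q / b₅)) := by
  simp only [wTerm, wpTerm, qPochs, List.map_cons, List.map_nil, List.prod_cons, List.prod_nil,
    mul_one, Fin.prod_univ_five, Matrix.cons_val, mul_div_mul_comm, qPoch_div_eq hq1 h,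
    qPoch_div_eq hq1 h₁, qPoch_div_eq hq1 h₂, qPoch_div_eq hq1 h₃, qPoch_div_eq hq1 h₄,
    qPoch_div_eq hq1 h₅]
  generalize 1 - a = w
  ring

lemma qPochInf_ne_zero_of_notMem_poles (hq1 : ‖q‖ < 1) {x : ℂ} (hz : z ≠ 0)
    (h : z ∉ poles q x) : qPochInf q (x * z) ≠ 0 ∧ qPochInf q (x / z) ≠ 0 := by
  refine ⟨qPochInf_ne_zero hq1 fun j hj => h ⟨j, Or.inr ?_⟩,
    qPochInf_ne_zero hq1 fun j hj => h ⟨j, Or.inl ?_⟩⟩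
  · exact eq_inv_of_mul_eq_one_left (by linear_combination -hj)
  · field_simp at hj
    linear_combination hj

lemma fCoeff_mul_Phi (hq : q ≠ 0) (hb : b ≠ 0) (hc : c ≠ 0) (hd : d ≠ 0) (he : e ≠ 0)
    (hz : z ≠ 0) (k : ℕ) :
    fCoeff q b c d e k * Phi q b c k z =
      wTerm q (b * c / q) [d, e, c ^ 2 / (d * e * q), b * z, b / z] q k := by
  have e0 : b * c * q ^ (2 * (k : ℤ) - 1) = b * c / q * q ^ (2 * k) := by
    rw [zpow_sub₀ hq, zpow_one]
    norm_cast
    ring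
  have e1 : b * c / q * q = b * c := by field_simp
  have e2 : b * c / (c ^ 2 / (d * e * q)) = b * d * e * q / c := by field_simp
  have e3 : b * c / (b * z) = c / z := by field_simp
  have e4 : b * c / (b / z) = c * z := by field_simp
  simp only [fCoeff, Phi, wTerm, qPochs, List.map_cons, List.map_nil, List.prod_cons,
    List.prod_nil, mul_one, e0, e1, e2, e3, e4, ← div_eq_mul_inv]
  ring

lemma gCoeff_mul_Psi (hq : q ≠ 0) (hb : b ≠ 0) (hc : c ≠ 0) (hd : d ≠ 0) (he : e ≠ 0)
    (hz : z ≠ 0) (k : ℕ) :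
    gCoeff q b c d e k * Psi q b c d e k z =
      wTerm q (c ^ 3 / (b * d ^ 2 * e ^ 2 * q))
        [c / (b * d), c / (b * e), c ^ 2 / (d * e * q), c * z / (d * e), c / (d * e * z)] q k := by
  have e0 : c ^ 3 * q ^ (2 * (k : ℤ) - 1) / (b * d ^ 2 * e ^ 2) =
      c ^ 3 / (b * d ^ 2 * e ^ 2 * q) * q ^ (2 * k) := by
    rw [zpow_sub₀ hq, zpow_one]
    norm_cast
    field_simp
  have e1 : c ^ 3 / (b * d ^ 2 * e ^ 2 * q) * q / (c / (b * d)) = c ^ 2 / (d * e ^ 2) := by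
    field_simp
  have e2 : c ^ 3 / (b * d ^ 2 * e ^ 2 * q) * q / (c / (b * e)) = c ^ 2 / (d ^ 2 * e) := by
    field_simp
  have e3 : c ^ 3 / (b * d ^ 2 * e ^ 2 * q) * q / (c ^ 2 / (d * e * q)) = c * q / (b * d * e) := by
    field_simp
  have e4 : c ^ 3 / (b * d ^ 2 * e ^ 2 * q) * q / (c * z / (d * e)) = c ^ 2 / (b * d * e * z) := by
    field_simp
  have e5 : c ^ 3 / (b * d ^ 2 * e ^ 2 * q) * q / (c / (d * e * z)) = c ^ 2 * z / (b * d * e) := by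
    field_simp
  simp only [gCoeff, Psi, wTerm, qPochs, List.map_cons, List.map_nil, List.prod_cons,
    List.prod_nil, mul_one, e0, e1, e2, e3, e4, e5]
  ring

end Kernel

/-! ### Clearing denominators at admissible points, and the pointwise identity. -/

section Kernel

variable {q b c d e z : ℂ}

/-- The denominator clearing the first series. -/
def fDen (q b c d e z : ℂ) : ℂ :=
  (1 - b * c / q) * qPochInf q q * qPochInf q (b * c / d) * qPochInf q (b * c / e) *
    qPochInf q (b * d * e * q / c) * qPochInf q (c / z) * qPochInf q (c * z)

/-- The denominator clearing the second series. -/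
def gDen (q b c d e z : ℂ) : ℂ :=
  (1 - c ^ 3 / (b * d ^ 2 * e ^ 2 * q)) * qPochInf q q * qPochInf q (c ^ 2 / (d * e ^ 2)) *
    qPochInf q (c ^ 2 / (d ^ 2 * e)) * qPochInf q (c * q / (b * d * e)) *
    qPochInf q (c ^ 2 / (b * d * e * z)) * qPochInf q (c ^ 2 * z / (b * d * e))

lemma admissible_ne (hq1 : ‖q‖ < 1) (hz : z ∈ admissible q b c d e) :
    qPochInf q (c * z) ≠ 0 ∧ qPochInf q (c / z) ≠ 0 ∧
      qPochInf q (c ^ 2 * z / (b * d * e)) ≠ 0 ∧ qPochInf q (c ^ 2 / (b * d * e * z)) ≠ 0 := by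
  obtain ⟨h0, h1, h2⟩ := hz
  obtain ⟨h3, h4⟩ := qPochInf_ne_zero_of_notMem_poles hq1 h0 h1
  obtain ⟨h5, h6⟩ := qPochInf_ne_zero_of_notMem_poles hq1 h0 h2
  rw [div_mul_eq_mul_div] at h5
  rw [div_div] at h6
  exact ⟨h3, h4, h5, h6⟩

lemma Generic.qPochInf_f_ne (hgen : Generic q b c d e) (hq1 : ‖q‖ < 1) :
    qPochInf q q ≠ 0 ∧ qPochInf q (b * c / d) ≠ 0 ∧ qPochInf q (b * c / e) ≠ 0 ∧
      qPochInf q (b * d * e * q / c) ≠ 0 := by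
  have h := hgen.f_den'
  simp only [qPochs, List.map_cons, List.map_nil, List.prod_cons, List.prod_nil, mul_one,
    mul_ne_zero_iff] at h
  exact ⟨qPochInf_ne_zero_of_qPoch hq1 fun k => (h k).1,
    qPochInf_ne_zero_of_qPoch hq1 fun k => (h k).2.1,
    qPochInf_ne_zero_of_qPoch hq1 fun k => (h k).2.2.1,
    qPochInf_ne_zero_of_qPoch hq1 fun k => (h k).2.2.2⟩

lemma Generic.qPochInf_g_ne (hgen : Generic q b c d e) (hq1 : ‖q‖ < 1) :
    qPochInf q (c ^ 2 / (d * e ^ 2)) ≠ 0 ∧ qPochInf q (c ^ 2 / (d ^ 2 * e)) ≠ 0 ∧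
      qPochInf q (c * q / (b * d * e)) ≠ 0 := by
  have h := hgen.g_den'
  simp only [qPochs, List.map_cons, List.map_nil, List.prod_cons, List.prod_nil, mul_one,
    mul_ne_zero_iff] at h
  exact ⟨qPochInf_ne_zero_of_qPoch hq1 fun k => (h k).2.1,
    qPochInf_ne_zero_of_qPoch hq1 fun k => (h k).2.2.1,
    qPochInf_ne_zero_of_qPoch hq1 fun k => (h k).2.2.2⟩

lemma fDen_ne_zero (hq1 : ‖q‖ < 1) (hgen : Generic q b c d e) (hz : z ∈ admissible q b c d e) :
    fDen q b c d e z ≠ 0 := by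
  obtain ⟨h0, h1, h2, h3⟩ := hgen.qPochInf_f_ne hq1
  obtain ⟨h4, h5, -, -⟩ := admissible_ne hq1 hz
  have h6 := hgen.f_den
  rw [← div_eq_mul_inv] at h6
  simp only [fDen, ne_eq, mul_eq_zero, not_or]
  tauto

lemma gDen_ne_zero (hq1 : ‖q‖ < 1) (hgen : Generic q b c d e) (hz : z ∈ admissible q b c d e) :
    gDen q b c d e z ≠ 0 := by
  obtain ⟨h0, -⟩ := hgen.qPochInf_f_ne hq1
  obtain ⟨h1, h2, h3⟩ := hgen.qPochInf_g_ne hq1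
  obtain ⟨-, -, h4, h5⟩ := admissible_ne hq1 hz
  have h6 := hgen.g_den
  simp only [gDen, ne_eq, mul_eq_zero, not_or]
  tauto

lemma fCoeff_mul_Phi_eq_wpTerm (hq : q ≠ 0) (hq1 : ‖q‖ < 1) (hgen : Generic q b c d e)
    (hz : z ∈ admissible q b c d e) (k : ℕ) :
    fCoeff q b c d e k * Phi q b c k z =
      wpTerm q (b * c / q) ![c ^ 2 / (d * e * q), d, e, b * z, b / z]
        ![b * d * e * q / c, b * c / d, b * c / e, c / z, c * z] k / fDen q b c d e z := by
  have hb := hgen.b_ne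
  have hc := hgen.c_ne
  have hd := hgen.d_ne
  have he := hgen.e_ne
  have hz0 : z ≠ 0 := hz.1
  have e1 : b * c / q * q = b * c := by field_simp
  have e2 : b * c / (c ^ 2 / (d * e * q)) = b * d * e * q / c := by field_simp
  have e3 : b * c / (b * z) = c / z := by field_simp
  have e4 : b * c / (b / z) = c * z := by field_simp
  obtain ⟨h0, h1, h2, h3⟩ := hgen.qPochInf_f_ne hq1
  obtain ⟨h4, h5, -, -⟩ := admissible_ne hq1 hz
  rw [fCoeff_mul_Phi hq hb hc hd he hz0, wTerm_eq_wpTerm_div hq1 h0] <;>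
    simp only [e1, e2, e3, e4, fDen] <;> assumption

lemma gCoeff_mul_Psi_eq_wpTerm (hq : q ≠ 0) (hq1 : ‖q‖ < 1) (hgen : Generic q b c d e)
    (hz : z ∈ admissible q b c d e) (k : ℕ) :
    gCoeff q b c d e k * Psi q b c d e k z =
      wpTerm q (c ^ 3 / (b * d ^ 2 * e ^ 2 * q))
        ![c ^ 2 / (d * e * q), c / (b * d), c / (b * e), c * z / (d * e), c / (d * e * z)]
        ![c * q / (b * d * e), c ^ 2 / (d * e ^ 2), c ^ 2 / (d ^ 2 * e), c ^ 2 / (b * d * e * z),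
          c ^ 2 * z / (b * d * e)] k / gDen q b c d e z := by
  have hb := hgen.b_ne
  have hc := hgen.c_ne
  have hd := hgen.d_ne
  have he := hgen.e_ne
  have hz0 : z ≠ 0 := hz.1
  have e1 : c ^ 3 / (b * d ^ 2 * e ^ 2 * q) * q / (c / (b * d)) = c ^ 2 / (d * e ^ 2) := by
    field_simp
  have e2 : c ^ 3 / (b * d ^ 2 * e ^ 2 * q) * q / (c / (b * e)) = c ^ 2 / (d ^ 2 * e) := by
    field_simp
  have e3 : c ^ 3 / (b * d ^ 2 * e ^ 2 * q) * q / (c ^ 2 / (d * e * q)) = c * q / (b * d * e) := by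
    field_simp
  have e4 : c ^ 3 / (b * d ^ 2 * e ^ 2 * q) * q / (c * z / (d * e)) = c ^ 2 / (b * d * e * z) := by
    field_simp
  have e5 : c ^ 3 / (b * d ^ 2 * e ^ 2 * q) * q / (c / (d * e * z)) = c ^ 2 * z / (b * d * e) := by
    field_simp
  obtain ⟨h0, -⟩ := hgen.qPochInf_f_ne hq1
  obtain ⟨h1, h2, h3⟩ := hgen.qPochInf_g_ne hq1
  obtain ⟨-, -, h4, h5⟩ := admissible_ne hq1 hz
  rw [gCoeff_mul_Psi hq hb hc hd he hz0, wTerm_eq_wpTerm_div hq1 h0] <;>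
    simp only [e1, e2, e3, e4, e5, gDen] <;> assumption

lemma tsum_fCoeff_mul_Phi (hq : q ≠ 0) (hq1 : ‖q‖ < 1) (hgen : Generic q b c d e)
    (hz : z ∈ admissible q b c d e) :
    ∑' k, fCoeff q b c d e k * Phi q b c k z =
      vwpSum q (b * c / q) (c ^ 2 / (d * e * q)) d e (b * z) (b / z) / fDen q b c d e z := by
  have hb := hgen.b_ne
  have hc := hgen.c_ne
  have hd := hgen.d_ne
  have he := hgen.e_ne
  have hz0 : z ≠ 0 := hz.1
  have e1 : b * c / q * q = b * c := by field_simp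
  have e2 : b * c / (c ^ 2 / (d * e * q)) = b * d * e * q / c := by field_simp
  have e3 : b * c / (b * z) = c / z := by field_simp
  have e4 : b * c / (b / z) = c * z := by field_simp
  simp only [fCoeff_mul_Phi_eq_wpTerm hq hq1 hgen hz, tsum_div_const, vwpSum, wpSum, e1, e2, e3, e4]

lemma tsum_gCoeff_mul_Psi (hq : q ≠ 0) (hq1 : ‖q‖ < 1) (hgen : Generic q b c d e)
    (hz : z ∈ admissible q b c d e) :
    ∑' k, gCoeff q b c d e k * Psi q b c d e k z =
      vwpSum q (c ^ 3 / (b * d ^ 2 * e ^ 2 * q)) (c ^ 2 / (d * e * q)) (c / (b * d)) (c / (b * e))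
        (c * z / (d * e)) (c / (d * e * z)) / gDen q b c d e z := by
  have hb := hgen.b_ne
  have hc := hgen.c_ne
  have hd := hgen.d_ne
  have he := hgen.e_ne
  have hz0 : z ≠ 0 := hz.1
  have e1 : c ^ 3 / (b * d ^ 2 * e ^ 2 * q) * q / (c / (b * d)) = c ^ 2 / (d * e ^ 2) := by
    field_simp
  have e2 : c ^ 3 / (b * d ^ 2 * e ^ 2 * q) * q / (c / (b * e)) = c ^ 2 / (d ^ 2 * e) := by
    field_simp
  have e3 : c ^ 3 / (b * d ^ 2 * e ^ 2 * q) * q / (c ^ 2 / (d * e * q)) = c * q / (b * d * e) := by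
    field_simp
  have e4 : c ^ 3 / (b * d ^ 2 * e ^ 2 * q) * q / (c * z / (d * e)) = c ^ 2 / (b * d * e * z) := by
    field_simp
  have e5 : c ^ 3 / (b * d ^ 2 * e ^ 2 * q) * q / (c / (d * e * z)) = c ^ 2 * z / (b * d * e) := by
    field_simp
  simp only [gCoeff_mul_Psi_eq_wpTerm hq hq1 hgen hz, tsum_div_const, vwpSum, wpSum, e1, e2, e3,
    e4, e5]

lemma H_at (q b c d e : ℂ) : H q c d e b =
    (qPochInf q (b * c / d) * qPochInf q (c / (b * d)) * qPochInf q (b * c / e) *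
      qPochInf q (c / (b * e))) / (qPochInf q (b * c) * qPochInf q (c / b) *
      qPochInf q (b * c / (d * e)) * qPochInf q (c / (b * d * e))) := by
  simp only [H, qPochsInf, List.map_cons, List.map_nil, List.prod_cons, List.prod_nil, mul_one]
  rw [mul_comm c b, mul_comm d b, mul_comm e b, show d * e * b = b * d * e by ring]
  ring

lemma K_at (hb : b ≠ 0) (hc : c ≠ 0) (hd : d ≠ 0) (he : e ≠ 0) :
    K q b c d e (c / (d * e)) =
    (qPochInf q (c ^ 2 / (d ^ 2 * e)) * qPochInf q e * qPochInf q (c ^ 2 / (d * e ^ 2)) *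
      qPochInf q d) / (qPochInf q (b * c / (d * e)) * qPochInf q (b * d * e / c) *
      qPochInf q (c ^ 3 / (b * d ^ 2 * e ^ 2)) * qPochInf q (c / b)) := by
  have e1 : c * (c / (d * e)) / d = c ^ 2 / (d ^ 2 * e) := by field_simp
  have e2 : c / (d * (c / (d * e))) = e := by field_simp
  have e3 : c * (c / (d * e)) / e = c ^ 2 / (d * e ^ 2) := by field_simp
  have e4 : c / (e * (c / (d * e))) = d := by field_simp
  have e5 : b * (c / (d * e)) = b * c / (d * e) := by ring
  have e6 : b / (c / (d * e)) = b * d * e / c := by field_simp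
  have e7 : c ^ 2 * (c / (d * e)) / (b * d * e) = c ^ 3 / (b * d ^ 2 * e ^ 2) := by field_simp
  have e8 : c ^ 2 / (b * d * e * (c / (d * e))) = c / b := by field_simp
  simp only [K, qPochsInf, List.map_cons, List.map_nil, List.prod_cons, List.prod_nil, mul_one,
    e1, e2, e3, e4, e5, e6, e7, e8]
  ring

lemma vwpSum_swap (q a b c d e f : ℂ) : vwpSum q a b c d e f = vwpSum q a b d c e f := by
  refine tsum_congr fun k => ?_
  simp only [wpTerm, Fin.prod_univ_five, Matrix.cons_val]
  ring

theorem F_eq (hq : q ≠ 0) (hq1 : ‖q‖ < 1) (hgen : Generic q b c d e)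
    (hz : z ∈ admissible q b c d e) :
    F q b c d e z =
      A q b c d e z * H q c d e b * ∑' k, fCoeff q b c d e k * Phi q b c k z +
      B q b c z * K q b c d e (c / (d * e)) *
        ∑' k, gCoeff q b c d e k * Psi q b c d e k z := by
  have hb := hgen.b_ne
  have hc := hgen.c_ne
  have hd := hgen.d_ne
  have he := hgen.e_ne
  have hz0 : z ≠ 0 := hz.1
  have hV1 := (eq_div_iff (fDen_ne_zero hq1 hgen hz)).1 (tsum_fCoeff_mul_Phi hq hq1 hgen hz)
  have hV2 := (eq_div_iff (gDen_ne_zero hq1 hgen hz)).1 (tsum_gCoeff_mul_Psi hq hq1 hgen hz)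
  -- Taking `e` before `d` makes the involution produce `c/(bd), c/(be)` in the order used by the
  -- second series; the first series is then reordered by `vwpSum_swap`.
  have hE := twoSum_eq (q := q) (a := b * c / q) (b := c ^ 2 / (d * e * q)) (c := e) (d := d)
    (e := b * z) (f := b / z) hq1 hq (by positivity) (by positivity) he hd (by positivity)
    (by positivity) (by field_simp)
  have r1 : (c ^ 2 / (d * e * q)) ^ 2 / (b * c / q) = c ^ 3 / (b * d ^ 2 * e ^ 2 * q) := by
    field_simp
  have r2 : c ^ 2 / (d * e * q) * e / (b * c / q) = c / (b * d) := by field_simp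
  have r3 : c ^ 2 / (d * e * q) * d / (b * c / q) = c / (b * e) := by field_simp
  have r4 : c ^ 2 / (d * e * q) * (b * z) / (b * c / q) = c * z / (d * e) := by field_simp
  have r5 : c ^ 2 / (d * e * q) * (b / z) / (b * c / q) = c / (d * e * z) := by field_simp
  have r6 : c ^ 2 / (d * e * q) / (b * c / q) = c / (b * d * e) := by field_simp
  have r7 : b * c / q * q = b * c := by field_simp
  have r8 : b * c / (c ^ 2 / (d * e * q)) = b * d * e * q / c := by field_simp
  have r9 : b * c / (e * d) = b * c / (d * e) := by rw [mul_comm e d]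
  have r10 : b * c / (e * (b * z)) = c / (e * z) := by field_simp
  have r11 : b * c / (e * (b / z)) = c * z / e := by field_simp
  have r12 : b * c / (d * (b * z)) = c / (d * z) := by field_simp
  have r13 : b * c / (d * (b / z)) = c * z / d := by field_simp
  have r14 : b * c / (b * z * (b / z)) = c / b := by field_simp
  have r15 : c ^ 3 / (b * d ^ 2 * e ^ 2 * q) * q = c ^ 3 / (b * d ^ 2 * e ^ 2) := by field_simp
  -- With `u = c/(bde)`, the ratio `b/a` of `twoSum`, the leading factors `1 - u` and `1 - u⁻¹` are
  -- split off. Since `1/(1 - u⁻¹) = -u/(1 - u)`, the minus sign and weight in `twoSum` become the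
  -- plus sign in the kernel formula.
  have hu : qPochInf q (c / (b * d * e)) =
      (1 - c / (b * d * e)) * qPochInf q (c * q / (b * d * e)) := by
    rw [qPochInf_eq hq1, div_mul_eq_mul_div]
  have hu' : qPochInf q (b * d * e / c) =
      (1 - (c / (b * d * e))⁻¹) * qPochInf q (b * d * e * q / c) := by
    rw [qPochInf_eq hq1, div_mul_eq_mul_div, inv_div]
  have hH := hgen.H_den
  have hK := hgen.K_den
  have hf := hgen.f_den
  have hg := hgen.g_den
  rw [← div_eq_mul_inv] at hf
  simp only [qPochsInf, List.map_cons, List.map_nil, List.prod_cons, List.prod_nil, mul_one,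
    mul_ne_zero_iff] at hH hK
  obtain ⟨hY, hcb, hP, hu0⟩ := hH
  obtain ⟨-, hu0', hX, -⟩ := hK
  rw [hu] at hu0
  rw [hu'] at hu0'
  obtain ⟨hiq, -, -, -⟩ := hgen.qPochInf_f_ne hq1
  obtain ⟨hz1, hz2, hz3, hz4⟩ := admissible_ne hq1 hz
  rw [H_at, K_at hb hc hd he]
  simp only [twoSum, pairProd, r1, r2, r3, r4, r5, r6, r7, r8, r9, r10, r11, r12, r13, r14] at hE
  rw [vwpSum_swap, ← hV1, ← hV2, fDen, gDen, qPochInf_eq hq1 (b * c / q),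
    qPochInf_eq hq1 (c ^ 3 / (b * d ^ 2 * e ^ 2 * q)), r7, r15] at hE
  rw [hu] at hE ⊢
  rw [hu']
  simp only [F, A, B, qPochsInf, List.map_cons, List.map_nil, List.prod_cons, List.prod_nil,
    mul_one]
  generalize ∑' k, fCoeff q b c d e k * Phi q b c k z = s₁ at *
  generalize ∑' k, gCoeff q b c d e k * Psi q b c d e k z = s₂ at *
  have hun : c / (b * d * e) ≠ 0 := by positivity
  have hu1 := left_ne_zero_of_mul hu0
  have hJ := right_ne_zero_of_mul hu0
  have hL := right_ne_zero_of_mul hu0'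
  clear hV1 hV2 hu hu' hu0 hu0' r1 r2 r3 r4 r5 r6 r7 r8 r9 r10 r11 r12 r13 r14 r15
  generalize c / (b * d * e) = u at *
  generalize 1 - b * c / q = w₁ at *
  generalize 1 - c ^ 3 / (b * d ^ 2 * e ^ 2 * q) = w₂ at *
  generalize qPochInf q (c * q / (b * d * e)) = J at *
  generalize qPochInf q (b * d * e * q / c) = M at *
  generalize qPochInf q q = iq at *
  generalize qPochInf q (c ^ 3 / (b * d ^ 2 * e ^ 2)) = X at *
  generalize qPochInf q (b * c) = Y at *
  generalize qPochInf q (b * c / (d * e)) = P at *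
  generalize qPochInf q (c / b) = R at *
  generalize qPochInf q (c * z) = z₁ at *
  generalize qPochInf q (c / z) = z₂ at *
  generalize qPochInf q (c ^ 2 * z / (b * d * e)) = z₃ at *
  generalize qPochInf q (c ^ 2 / (b * d * e * z)) = z₄ at *
  have hu2 : u - 1 ≠ 0 := fun h => hu1 (by linear_combination -h)
  generalize qPochInf q (c * z / d) = p₁ at *
  generalize qPochInf q (c / (d * z)) = p₂ at *
  generalize qPochInf q (c * z / e) = p₃ at *
  generalize qPochInf q (c / (e * z)) = p₄ at *
  -- The kernel is expanded so that its numerator is exactly the product side of `hE`, which can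
  -- then be replaced by the two series.
  rw [show p₁ * (p₂ * (p₃ * p₄)) / (z₁ * (z₂ * (z₃ * z₄))) =
    (iq * M * ((1 - u) * J) * (w₁ * Y * (w₂ * X) * (P * p₄ * p₃ * p₂ * p₁ * R))) /
      (iq * M * (1 - u) * J * w₁ * w₂ * Y * X * P * R * z₁ * z₂ * z₃ * z₄) by field_simp, ← hE]
  field_simp
  ring

end Kernel

/-! ### Uniform convergence on compact sets of admissible points. -/

section Uniform

variable {q b c d e : ℂ} {L : Set ℂ}

/-- By compactness the parameters and `1/D` are bounded on `L`, so `norm_wpTerm_le` holds with one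
constant, as the Weierstrass test requires. -/
lemma exists_bound_wpTerm_div (hq1 : ‖q‖ < 1) (hL : IsCompact L) (a : ℂ) {u v : ℂ → Fin 5 → ℂ}
    {D : ℂ → ℂ} (hu : ContinuousOn u L) (hv : ContinuousOn v L) (hD : ContinuousOn D L)
    (hD0 : ∀ z ∈ L, D z ≠ 0) :
    ∃ C : ℝ, ∀ z ∈ L, ∀ k, ‖wpTerm q a (u z) (v z) k / D z‖ ≤ C * ‖q‖ ^ k := by
  obtain ⟨R₁, h₁⟩ := hL.exists_bound_of_continuousOn hu
  obtain ⟨R₂, h₂⟩ := hL.exists_bound_of_continuousOn hv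
  obtain ⟨R₃, h₃⟩ := hL.exists_bound_of_continuousOn (hD.inv₀ hD0)
  set ρ := 1 + ‖a‖ + |R₁| + |R₂|
  have n1 := norm_nonneg a
  have n2 := abs_nonneg R₁
  have n3 := abs_nonneg R₂
  refine ⟨(1 + ρ) * pochBound q ρ ^ 12 * R₃, fun z hz k => ?_⟩
  have h := norm_wpTerm_le (u := u z) (v := v z) (ρ := ρ) hq1 (by linarith) (a := a)
    (by linarith)
    (fun i => by linarith [norm_le_pi_norm (u z) i, h₁ z hz, le_abs_self R₁])
    (fun i => by linarith [norm_le_pi_norm (v z) i, h₂ z hz, le_abs_self R₂]) k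
  rw [div_eq_mul_inv, norm_mul]
  calc _ ≤ (1 + ρ) * pochBound q ρ ^ 12 * ‖q‖ ^ k * R₃ :=
        mul_le_mul h (h₃ z hz) (norm_nonneg _) ((norm_nonneg _).trans h)
    _ = _ := by ring

lemma continuousOn_vec5 {x₀ x₁ x₂ x₃ x₄ : ℂ → ℂ} (h₀ : ContinuousOn x₀ L)
    (h₁ : ContinuousOn x₁ L) (h₂ : ContinuousOn x₂ L) (h₃ : ContinuousOn x₃ L)
    (h₄ : ContinuousOn x₄ L) :
    ContinuousOn (fun z => ![x₀ z, x₁ z, x₂ z, x₃ z, x₄ z]) L := by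
  refine continuousOn_pi.2 fun i => ?_
  fin_cases i <;> assumption

lemma continuousOn_div_const_mul (hL0 : ∀ z ∈ L, z ≠ 0) (x y : ℂ) :
    ContinuousOn (fun z => x / (y * z)) L := by
  have h : ContinuousOn (fun z : ℂ => x / y * z⁻¹) L :=
    continuousOn_const.mul (continuousOn_id.inv₀ hL0)
  refine h.congr fun z _ => ?_
  rw [← div_div, div_eq_mul_inv _ z]

lemma continuousOn_const_div (hL0 : ∀ z ∈ L, z ≠ 0) (x : ℂ) :
    ContinuousOn (fun z => x / z) L := by
  simpa using continuousOn_div_const_mul hL0 x 1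

lemma exists_bound_fCoeff (hq : q ≠ 0) (hq1 : ‖q‖ < 1) (hgen : Generic q b c d e)
    (hL : IsCompact L) (hadm : L ⊆ admissible q b c d e) :
    ∃ C : ℝ, ∀ z ∈ L, ∀ k, ‖fCoeff q b c d e k * Phi q b c k z‖ ≤ C * ‖q‖ ^ k := by
  have hL0 : ∀ z ∈ L, z ≠ 0 := fun z hz => (hadm hz).1
  have hI := continuous_qPochInf hq1
  have hm (x : ℂ) : ContinuousOn (fun z => x * z) L := by fun_prop
  have hdiv (x : ℂ) := continuousOn_const_div hL0 x
  have hc (x : ℂ) : ContinuousOn (fun _ : ℂ => x) L := continuousOn_const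
  obtain ⟨C, hC⟩ := exists_bound_wpTerm_div hq1 hL (b * c / q)
    (continuousOn_vec5 (hc (c ^ 2 / (d * e * q))) (hc d) (hc e) (hm b) (hdiv b))
    (continuousOn_vec5 (hc (b * d * e * q / c)) (hc (b * c / d)) (hc (b * c / e)) (hdiv c) (hm c))
    (D := fDen q b c d e)
    ((continuousOn_const.mul (hI.comp_continuousOn (hdiv c))).mul (hI.comp_continuousOn (hm c)))
    (fun z hz => fDen_ne_zero hq1 hgen (hadm hz))
  refine ⟨C, fun z hz k => ?_⟩
  rw [fCoeff_mul_Phi_eq_wpTerm hq hq1 hgen (hadm hz)]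
  exact hC z hz k

lemma exists_bound_gCoeff (hq : q ≠ 0) (hq1 : ‖q‖ < 1) (hgen : Generic q b c d e)
    (hL : IsCompact L) (hadm : L ⊆ admissible q b c d e) :
    ∃ C : ℝ, ∀ z ∈ L, ∀ k, ‖gCoeff q b c d e k * Psi q b c d e k z‖ ≤ C * ‖q‖ ^ k := by
  have hL0 : ∀ z ∈ L, z ≠ 0 := fun z hz => (hadm hz).1
  have hI := continuous_qPochInf hq1
  have hm (x y : ℂ) : ContinuousOn (fun z => x * z / y) L := by fun_prop
  have hdiv (x y : ℂ) := continuousOn_div_const_mul hL0 x y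
  have hc (x : ℂ) : ContinuousOn (fun _ : ℂ => x) L := continuousOn_const
  obtain ⟨C, hC⟩ := exists_bound_wpTerm_div hq1 hL (c ^ 3 / (b * d ^ 2 * e ^ 2 * q))
    (continuousOn_vec5 (hc (c ^ 2 / (d * e * q))) (hc (c / (b * d))) (hc (c / (b * e)))
      (hm c (d * e)) (hdiv c (d * e)))
    (continuousOn_vec5 (hc (c * q / (b * d * e))) (hc (c ^ 2 / (d * e ^ 2)))
      (hc (c ^ 2 / (d ^ 2 * e))) (hdiv (c ^ 2) (b * d * e)) (hm (c ^ 2) (b * d * e)))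
    (D := gDen q b c d e)
    ((continuousOn_const.mul (hI.comp_continuousOn (hdiv (c ^ 2) (b * d * e)))).mul
      (hI.comp_continuousOn (hm (c ^ 2) (b * d * e))))
    (fun z hz => gDen_ne_zero hq1 hgen (hadm hz))
  refine ⟨C, fun z hz k => ?_⟩
  rw [gCoeff_mul_Psi_eq_wpTerm hq hq1 hgen (hadm hz)]
  exact hC z hz k

lemma continuousOn_A (hq1 : ‖q‖ < 1) (hadm : L ⊆ admissible q b c d e) :
    ContinuousOn (A q b c d e) L := by
  have hL0 : ∀ z ∈ L, z ≠ 0 := fun z hz => (hadm hz).1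
  have hI := continuous_qPochInf hq1
  have hm (x y : ℂ) : ContinuousOn (fun z => qPochInf q (x * z / y)) L :=
    hI.comp_continuousOn (by fun_prop)
  have hdiv (x y : ℂ) : ContinuousOn (fun z => qPochInf q (x / (y * z))) L :=
    hI.comp_continuousOn (continuousOn_div_const_mul hL0 x y)
  refine (((hm c (d * e)).mul (hdiv c (d * e))).div
    ((hm (c ^ 2) (b * d * e)).mul (hdiv (c ^ 2) (b * d * e))) fun z hz => ?_).congr fun z _ => ?_
  · obtain ⟨-, -, h1, h2⟩ := admissible_ne hq1 (hadm hz)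
    exact mul_ne_zero h1 h2
  · simp [A, qPochsInf]

lemma continuousOn_B (hq1 : ‖q‖ < 1) (hadm : L ⊆ admissible q b c d e) :
    ContinuousOn (B q b c) L := by
  have hL0 : ∀ z ∈ L, z ≠ 0 := fun z hz => (hadm hz).1
  have hI := continuous_qPochInf hq1
  have hm (x : ℂ) : ContinuousOn (fun z => qPochInf q (x * z)) L :=
    hI.comp_continuousOn (by fun_prop)
  have hdiv (x : ℂ) : ContinuousOn (fun z => qPochInf q (x / z)) L :=
    hI.comp_continuousOn (continuousOn_const_div hL0 x)
  refine (((hm b).mul (hdiv b)).div ((hm c).mul (hdiv c)) fun z hz => ?_).congr fun z _ => ?_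
  · obtain ⟨h1, h2, -, -⟩ := admissible_ne hq1 (hadm hz)
    exact mul_ne_zero h1 h2
  · simp [B, qPochsInf]

lemma summable_fCoeff_mul_Phi (hq : q ≠ 0) (hq1 : ‖q‖ < 1) (hgen : Generic q b c d e) {z : ℂ}
    (hz : z ∈ admissible q b c d e) :
    Summable fun k : ℕ => fCoeff q b c d e k * Phi q b c k z := by
  simp only [fCoeff_mul_Phi_eq_wpTerm hq hq1 hgen hz]
  exact (summable_wpTerm hq1 _ _ _).div_const _

lemma summable_gCoeff_mul_Psi (hq : q ≠ 0) (hq1 : ‖q‖ < 1) (hgen : Generic q b c d e) {z : ℂ}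
    (hz : z ∈ admissible q b c d e) :
    Summable fun k : ℕ => gCoeff q b c d e k * Psi q b c d e k z := by
  simp only [gCoeff_mul_Psi_eq_wpTerm hq hq1 hgen hz]
  exact (summable_wpTerm hq1 _ _ _).div_const _

/-- The prefactors are continuous, hence bounded on `L`, so the Weierstrass test applies to the
combined summand; `F_eq` identifies the limit. -/
lemma tendstoUniformlyOn_F (hq : q ≠ 0) (hq1 : ‖q‖ < 1) (hgen : Generic q b c d e)
    (hL : IsCompact L) (hadm : L ⊆ admissible q b c d e) :
    TendstoUniformlyOn
      (fun (N : ℕ) (z : ℂ) =>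
        A q b c d e z * H q c d e b *
          ∑ k ∈ Finset.range N, fCoeff q b c d e k * Phi q b c k z +
        B q b c z * K q b c d e (c / (d * e)) *
          ∑ k ∈ Finset.range N, gCoeff q b c d e k * Psi q b c d e k z)
      (F q b c d e) atTop L := by
  obtain ⟨C₁, h₁⟩ := exists_bound_fCoeff hq hq1 hgen hL hadm
  obtain ⟨C₂, h₂⟩ := exists_bound_gCoeff hq hq1 hgen hL hadm
  obtain ⟨R₁, hA⟩ := hL.exists_bound_of_continuousOn
    ((continuousOn_A hq1 hadm).mul (continuousOn_const (c := H q c d e b)))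
  obtain ⟨R₂, hB⟩ := hL.exists_bound_of_continuousOn
    ((continuousOn_B hq1 hadm).mul (continuousOn_const (c := K q b c d e (c / (d * e)))))
  have key := tendstoUniformlyOn_tsum_nat (s := L)
    (f := fun k z => A q b c d e z * H q c d e b * (fCoeff q b c d e k * Phi q b c k z) +
      B q b c z * K q b c d e (c / (d * e)) * (gCoeff q b c d e k * Psi q b c d e k z))
    ((summable_geometric_of_lt_one (norm_nonneg q) hq1).mul_left (R₁ * C₁ + R₂ * C₂))
    (fun k z hz => by
      refine (norm_add_le _ _).trans ?_
      rw [norm_mul, norm_mul (B q b c z * _), add_mul, mul_assoc R₁, mul_assoc R₂]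
      exact add_le_add
        (mul_le_mul (hA z hz) (h₁ z hz k) (norm_nonneg _) ((norm_nonneg _).trans (hA z hz)))
        (mul_le_mul (hB z hz) (h₂ z hz k) (norm_nonneg _) ((norm_nonneg _).trans (hB z hz))))
  refine (key.congr (Eventually.of_forall fun N z _ => ?_)).congr_right fun z hz => ?_
  · simp only [Finset.sum_add_distrib, Finset.mul_sum]
  · have s1 := summable_fCoeff_mul_Phi hq hq1 hgen (hadm hz)
    have s2 := summable_gCoeff_mul_Psi hq hq1 hgen (hadm hz)
    simp only
    rw [F_eq hq hq1 hgen (hadm hz), (s1.mul_left _).tsum_add (s2.mul_left _), tsum_mul_left,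
      tsum_mul_left]

end Uniform

end TwoBasis

end

/-! ### The kernel expansion in its equivalent forms. -/

theorem mainTheorem1 (q b c d e : ℂ) (hq0 : 0 < ‖q‖) (hq1 : ‖q‖ < 1)
    (hgen : Generic q b c d e) :
    -- convergence and the identity at every admissible point
    (∀ z ∈ admissible q b c d e,
      Summable (fun k : ℕ => fCoeff q b c d e k * Phi q b c k z) ∧
      Summable (fun k : ℕ => gCoeff q b c d e k * Psi q b c d e k z) ∧
      F q b c d e z =
        A q b c d e z * H q c d e b * ∑' k : ℕ, fCoeff q b c d e k * Phi q b c k z +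
        B q b c z * K q b c d e (c / (d * e)) *
          ∑' k : ℕ, gCoeff q b c d e k * Psi q b c d e k z) ∧
    -- uniform convergence on symmetric pole-free compact sets
    (∀ L : Set ℂ, IsCompact L → (∀ z ∈ L, z⁻¹ ∈ L) → L ⊆ admissible q b c d e →
      TendstoUniformlyOn
        (fun (N : ℕ) (z : ℂ) => ∑ k ∈ Finset.range N, fCoeff q b c d e k * Phi q b c k z)
        (fun z => ∑' k : ℕ, fCoeff q b c d e k * Phi q b c k z) Filter.atTop L ∧
      TendstoUniformlyOn
        (fun (N : ℕ) (z : ℂ) => ∑ k ∈ Finset.range N, gCoeff q b c d e k * Psi q b c d e k z)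
        (fun z => ∑' k : ℕ, gCoeff q b c d e k * Psi q b c d e k z) Filter.atTop L ∧
      TendstoUniformlyOn
        (fun (N : ℕ) (z : ℂ) =>
          A q b c d e z * H q c d e b *
            ∑ k ∈ Finset.range N, fCoeff q b c d e k * Phi q b c k z +
          B q b c z * K q b c d e (c / (d * e)) *
            ∑ k ∈ Finset.range N, gCoeff q b c d e k * Psi q b c d e k z)
        (F q b c d e) Filter.atTop L) ∧
    -- the expanded form
    (∀ z ∈ admissible q b c d e,
      qPochsInf q [c * z / d, c / (d * z), c * z / e, c / (e * z)] /
          qPochsInf q [c * z, c / z, c ^ 2 * z / (b * d * e), c ^ 2 / (b * d * e * z)] =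
        qPochsInf q [c * z / (d * e), c / (d * e * z)] /
            qPochsInf q [c ^ 2 * z / (b * d * e), c ^ 2 / (b * d * e * z)] * H q c d e b *
          ∑' k : ℕ, (1 - b * c * q ^ (2 * (k : ℤ) - 1)) / (1 - b * c * q⁻¹) *
            (qPochs q [b * c * q⁻¹, d, e, c ^ 2 / (d * e * q), b * z, b / z] k /
              qPochs q [q, b * c / d, b * c / e, b * d * e * q / c, c * z, c / z] k) * q ^ k +
        qPochsInf q [b * z, b / z] / qPochsInf q [c * z, c / z] *
            K q b c d e (c / (d * e)) *
          ∑' k : ℕ, (1 - c ^ 3 * q ^ (2 * (k : ℤ) - 1) / (b * d ^ 2 * e ^ 2)) /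
              (1 - c ^ 3 / (b * d ^ 2 * e ^ 2 * q)) *
            (qPochs q [c ^ 3 / (b * d ^ 2 * e ^ 2 * q), c / (b * d), c / (b * e),
                c ^ 2 / (d * e * q), c * z / (d * e), c / (d * e * z)] k /
              qPochs q [q, c ^ 2 / (d * e ^ 2), c ^ 2 / (d ^ 2 * e), c * q / (b * d * e),
                c ^ 2 * z / (b * d * e), c ^ 2 / (b * d * e * z)] k) * q ^ k) ∧
    -- the nonterminating very-well-poised `₈W₇` form
    (∀ z ∈ admissible q b c d e,
      F q b c d e z =
        A q b c d e z * H q c d e b *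
          ∑' k : ℕ, wTerm q (b * c / q) [d, e, c ^ 2 / (d * e * q), b * z, b / z] q k +
        B q b c z * K q b c d e (c / (d * e)) *
          ∑' k : ℕ, wTerm q (c ^ 3 / (b * d ^ 2 * e ^ 2 * q))
            [c / (b * d), c / (b * e), c ^ 2 / (d * e * q), c * z / (d * e), c / (d * e * z)]
            q k) := by
  have hq : q ≠ 0 := norm_pos_iff.1 hq0
  have hb := hgen.b_ne
  have hc := hgen.c_ne
  have hd := hgen.d_ne
  have he := hgen.e_ne
  refine ⟨fun z hz => ⟨summable_fCoeff_mul_Phi hq hq1 hgen hz,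
    summable_gCoeff_mul_Psi hq hq1 hgen hz, F_eq hq hq1 hgen hz⟩, fun L hL _ hadm => ⟨?_, ?_,
    tendstoUniformlyOn_F hq hq1 hgen hL hadm⟩, fun z hz => ?_, fun z hz => ?_⟩
  · obtain ⟨C, hC⟩ := exists_bound_fCoeff hq hq1 hgen hL hadm
    exact tendstoUniformlyOn_tsum_nat
      ((summable_geometric_of_lt_one (norm_nonneg q) hq1).mul_left C) fun k z hz => hC z hz k
  · obtain ⟨C, hC⟩ := exists_bound_gCoeff hq hq1 hgen hL hadm
    exact tendstoUniformlyOn_tsum_nat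
      ((summable_geometric_of_lt_one (norm_nonneg q) hq1).mul_left C) fun k z hz => hC z hz k
  · refine (F_eq hq hq1 hgen hz).trans ?_
    unfold A B
    congr 2
    · refine tsum_congr fun k => ?_
      simp only [fCoeff, Phi, qPochs, List.map_cons, List.map_nil, List.prod_cons, List.prod_nil,
        mul_one]
      ring
    · refine tsum_congr fun k => ?_
      simp only [gCoeff, Psi, qPochs, List.map_cons, List.map_nil, List.prod_cons, List.prod_nil,
        mul_one]
      ring
  · simp only [F_eq hq hq1 hgen hz, fCoeff_mul_Phi hq hb hc hd he hz.1,
      gCoeff_mul_Psi hq hb hc hd he hz.1]
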